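/- Throughout, a system $(X,T)$ is a homeomorphism $T$ of a compact metric space $X$ with its Borel $\sigma$-algebra. It is minimal if all orbits $\{T^nx:n\in\mathbb Z\}$ are dense, uniquely ergodic if it has exactly one invariant Borel probability measure, and strictly ergodic if it is both. A factor map $\pi:(X,T)\to(Z,S)$ is a continuous surjection with $\pi T=S\pi$. $(X,T)$ is an isomorphic extension of $(Z,S)$ via $\pi$ if both systems are uniquely ergodic, with invariant measures $\mu,\nu$, and $\pi$ is a factor map which is also a measure-theoretic isomorphism (invertible modulo null sets) of $(X,\mu,T)$ and $(Z,\nu,S)$. $(X,T)$ is an almost one-to-one extension of $(Z,S)$ if for some factor map $\pi:(X,T)\to(Z,S)$ the union of the singleton fibers of $\pi$ is dense in $X$. Let $Y$ be a nonempty compact metric space and let $\mathcal H(Y)$ be its homeomorphism group with the uniform metric $d(g,h)=\sup_{y}d(g(y),h(y))$. Let $\mathcal G\le\mathcal H(Y)$ be a subgroup, and let $C(Z,\mathcal G)$ be the space of continuous maps $G:Z\to\mathcal G$, $z\mapsto G_z$ (cocycles), with the uniform metric. Let $\mathsf{Cob}(\mathcal G)$ be the set of coboundaries $z\mapsto H_{Sz}^{-1}H_z$,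 $H\in C(Z,\mathcal G)$, and $\overline{\mathsf{Cob}}(\mathcal G)$ its closure in $C(Z,\mathcal G)$. For a cocycle $G$ let $T_G(z,y)=(Sz,G_z(y))$ on $X=Z\times Y$. **Theorem 3.1.** (1) Let $(Z,S)$ be a strictly ergodic system with $Z$ infinite, and let $\mathcal G$ be a pathwise connected subgroup of $\mathcal H(Y)$ such that (A) for every nonempty open $V\subseteq Y$ and every $\epsilon>0$ there are $M\ge1$ and $h_1,\dots,h_M\in\mathcal G$ with $\frac1M\sum_{j=1}^M\mathbf 1_{h_j(Y\setminus V)}(y)\le\epsilon$ for all $y\in Y$. Then there is a residual subset $R$ of $\overline{\mathsf{Cob}}(\mathcal G)$ (one containing a countable intersection of dense open sets) such that for every $G\in R$ the system $(X,T_G)$ is minimal and is an isomorphic extension of $(Z,S)$ via the projection $X\to Z$. If $\mathcal G$ is closed in $\mathcal H(Y)$, then $R$ contains a dense $G_\delta$ subset of $\overline{\mathsf{Cob}}(\mathcal G)$. (2) Consequently there are isomorphic extensions that are not almost one-to-one, and the question of Li, Tu and Ye (is every minimal Weyl mean equicontinuous system an almost one-to-one extension of its maximal equicontinuous factor?) has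 a negative answer: there are an infinite minimal system $(X,T)$ that is Weyl mean equicontinuous and an infinite system $(Z,S)$ that is the maximal equicontinuous factor of $(X,T)$ via a factor map $\pi$, such that $(X,T)$ is an isomorphic extension of $(Z,S)$ via $\pi$ but is not an almost one-to-one extension of $(Z,S)$. Here $(X,T)$ is Weyl mean equicontinuous if for every $\epsilon>0$ there is $\delta>0$ such that $d(x,y)<\delta$ implies $\limsup_{n-m\to\infty}\frac1{n-m}\sum_{i=m}^{n-1}d(T^ix,T^iy)<\epsilon$ ($m<n$ in $\mathbb Z$). A factor map $\pi:(X,T)\to(Z,S)$ is the maximal equicontinuous factor if $\{S^n:n\in\mathbb Z\}$ is equicontinuous and every factor map from $(X,T)$ onto an equicontinuous system factors through $\pi$. -/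

import Mathlib

open MeasureTheory Filter Topology

universe u v

/-! ## Topological dynamical systems

A system `(X, T)` is a homeomorphism `T : X ≃ₜ X` of a compact metric space `X`, which carries its
Borel σ-algebra. Powers `T ^ n` are taken in the group `X ≃ₜ X` (multiplication is composition). -/

/-- `(X, T)` is minimal: every (two-sided) orbit is dense. -/
def IsMinimalSystem {X : Type*} [TopologicalSpace X] (T : X ≃ₜ X) : Prop :=
  ∀ x : X, Dense (Set.range fun n : ℤ => (T ^ n) x)

/-- `μ` is the unique `T`-invariant Borel probability measure. -/
def IsUniqueInvariantMeasure {X : Type*} [TopologicalSpace X] [MeasurableSpace X]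
    (T : X ≃ₜ X) (μ : ProbabilityMeasure X) : Prop :=
  ∀ μ' : ProbabilityMeasure X,
    MeasurePreserving T (μ' : Measure X) (μ' : Measure X) ↔ μ' = μ

/-- `(X, T)` is uniquely ergodic: there is exactly one invariant Borel probability measure. -/
def IsUniquelyErgodic {X : Type*} [TopologicalSpace X] [MeasurableSpace X] (T : X ≃ₜ X) : Prop :=
  ∃ μ : ProbabilityMeasure X, IsUniqueInvariantMeasure T μ

/-- `(X, T)` is strictly ergodic: minimal and uniquely ergodic. -/
def IsStrictlyErgodic {X : Type*} [TopologicalSpace X] [MeasurableSpace X] (T : X ≃ₜ X) : Prop :=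
  IsMinimalSystem T ∧ IsUniquelyErgodic T

/-- `π` is a topological factor map from `(X, T)` onto `(Z, S)`. -/
def IsFactorMap {X Z : Type*} [TopologicalSpace X] [TopologicalSpace Z]
    (T : X ≃ₜ X) (S : Z ≃ₜ Z) (π : X → Z) : Prop :=
  Continuous π ∧ Function.Surjective π ∧ ∀ x, π (T x) = S (π x)

/-- `π` is an isomorphism mod 0 of the measure spaces `(X, μ)` and `(Z, ν)`: it preserves the
measures and has a measure preserving inverse up to null sets. -/
def IsMeasureIso {X Z : Type*} [MeasurableSpace X] [MeasurableSpace Z]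
    (μ : Measure X) (ν : Measure Z) (π : X → Z) : Prop :=
  MeasurePreserving π μ ν ∧
    ∃ φ : Z → X, MeasurePreserving φ ν μ ∧ (∀ᵐ x ∂μ, φ (π x) = x) ∧ (∀ᵐ z ∂ν, π (φ z) = z)

/-- `(X, T)` is an isomorphic extension of `(Z, S)`, realized by the map `π`: both systems are
uniquely ergodic, and `π` is a topological factor map which is a measure-theoretic isomorphism for
the unique invariant measures. -/
def IsIsomorphicExtensionVia {X Z : Type*} [TopologicalSpace X] [MeasurableSpace X]
    [TopologicalSpace Z] [MeasurableSpace Z]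
    (T : X ≃ₜ X) (S : Z ≃ₜ Z) (π : X → Z) : Prop :=
  IsFactorMap T S π ∧
    ∃ (μ : ProbabilityMeasure X) (ν : ProbabilityMeasure Z),
      IsUniqueInvariantMeasure T μ ∧ IsUniqueInvariantMeasure S ν ∧
        IsMeasureIso (μ : Measure X) (ν : Measure Z) π

/-- `(X, T)` is an almost one-to-one extension of `(Z, S)`: for some topological factor map the
union of the singleton fibers is dense. -/
def IsAlmostOneToOneExtension {X Z : Type*} [TopologicalSpace X] [TopologicalSpace Z]
    (T : X ≃ₜ X) (S : Z ≃ₜ Z) : Prop :=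
  ∃ π : X → Z, IsFactorMap T S π ∧ Dense {x : X | ∀ x', π x' = π x → x' = x}

/-- `(Z, S)` is equicontinuous: the family of all powers of `S` is equicontinuous. -/
def IsEquicontinuousSystem {Z : Type*} [UniformSpace Z] (S : Z ≃ₜ Z) : Prop :=
  Equicontinuous fun (n : ℤ) (z : Z) => (S ^ n) z

/-- `π` is the maximal equicontinuous factor of `(X, T)`: `(Z, S)` is equicontinuous and every
equicontinuous (compact metric) factor of `(X, T)` factors through `π`. -/
def IsMaximalEquicontinuousFactor {X Z : Type u} [TopologicalSpace X] [UniformSpace Z]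
    (T : X ≃ₜ X) (S : Z ≃ₜ Z) (π : X → Z) : Prop :=
  IsFactorMap T S π ∧ IsEquicontinuousSystem S ∧
    ∀ (Z' : Type u) [MetricSpace Z'] [CompactSpace Z'] (S' : Z' ≃ₜ Z') (π' : X → Z'),
      IsFactorMap T S' π' → IsEquicontinuousSystem S' →
        ∃ θ : Z → Z', IsFactorMap S S' θ ∧ ∀ x, π' x = θ (π x)

/-- The Weyl distance: the upper limit, as `n - m → ∞`, of the averages of `d (T^i x, T^i y)` over
`m ≤ i < n` (`m`, `n` integers). -/
noncomputable def weylDist {X : Type*} [MetricSpace X] (T : X ≃ₜ X) (x y : X) : ℝ :=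
  limsup
    (fun p : ℤ × ℤ =>
      (∑ i ∈ Finset.Ico p.1 p.2, dist ((T ^ i) x) ((T ^ i) y)) / ((p.2 : ℝ) - (p.1 : ℝ)))
    (comap (fun p : ℤ × ℤ => p.2 - p.1) atTop)

/-- `(X, T)` is Weyl mean equicontinuous. -/
def IsWeylMeanEquicontinuous {X : Type*} [MetricSpace X] (T : X ≃ₜ X) : Prop :=
  ∀ ε > 0, ∃ δ > 0, ∀ x y : X, dist x y < δ → weylDist T x y < ε

/-! ## The homeomorphism group, cocycles and skew products -/

/-- The uniform metric `d (g, h) = sup_y d (g y, h y)` on the group of homeomorphisms of a compact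
metric space, induced from the supremum metric of `C(Y, Y)`. -/
noncomputable instance homeoUniformMetric {Y : Type*} [MetricSpace Y] [CompactSpace Y] :
    MetricSpace (Y ≃ₜ Y) :=
  MetricSpace.induced (fun g => (⟨g, g.continuous⟩ : C(Y, Y)))
    (fun _ _ h => Homeomorph.ext fun y => DFunLike.congr_fun h y) inferInstance

/-- Condition (A): for every nonempty open `V` and `ε > 0` there are `M ≥ 1` and
`h_1, …, h_M` in `𝒢` with `(1 / M) ∑ j, 1_{h_j (Y \ V)} (y) ≤ ε` for all `y`. -/
def ConditionA {Y : Type*} [TopologicalSpace Y] (𝒢 : Subgroup (Y ≃ₜ Y)) : Prop :=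
  ∀ V : Set Y, IsOpen V → V.Nonempty → ∀ ε : ℝ, 0 < ε →
    ∃ (M : ℕ) (_ : 0 < M) (h : Fin M → (Y ≃ₜ Y)), (∀ j, h j ∈ 𝒢) ∧
      ∀ y : Y, (1 / (M : ℝ)) * ∑ j, Set.indicator (h j '' Vᶜ) (fun _ => (1 : ℝ)) y ≤ ε

/-- The set `Cob(𝒢)` of coboundaries `z ↦ (H (S z))⁻¹ * H z`, for `H` in `C(Z, 𝒢)`. The space
`C(Z, 𝒢)` of cocycles carries the uniform metric. -/
def coboundaries {Z Y : Type*} [MetricSpace Z] [CompactSpace Z] [MetricSpace Y] [CompactSpace Y]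
    (S : Z ≃ₜ Z) (𝒢 : Subgroup (Y ≃ₜ Y)) : Set C(Z, 𝒢) :=
  {G | ∃ H : C(Z, 𝒢), ∀ z, G z = (H (S z))⁻¹ * H z}

theorem continuous_skewProduct {Z Y : Type*} [MetricSpace Z] [CompactSpace Z] [MetricSpace Y]
    [CompactSpace Y] (S : Z ≃ₜ Z) (𝒢 : Subgroup (Y ≃ₜ Y)) (G : C(Z, 𝒢)) :
    Continuous fun p : Z × Y => (S p.1, (G p.1 : Y ≃ₜ Y) p.2) := by
  have h1 : Continuous fun g : Y ≃ₜ Y => (⟨g, g.continuous⟩ : C(Y, Y)) :=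
    continuous_induced_dom
  have h2 : Continuous fun p : Z × Y =>
      (⟨(G p.1 : Y ≃ₜ Y), (G p.1 : Y ≃ₜ Y).continuous⟩ : C(Y, Y)) :=
    h1.comp (continuous_subtype_val.comp (G.continuous.comp continuous_fst))
  have h3 := h2.eval continuous_snd
  exact (S.continuous.comp continuous_fst).prodMk h3

/-- The skew product `T_G (z, y) = (S z, G_z (y))`, a homeomorphism of `Z × Y`. -/
noncomputable def skewProduct {Z Y : Type*} [MetricSpace Z] [CompactSpace Z] [MetricSpace Y]
    [CompactSpace Y] (S : Z ≃ₜ Z) (𝒢 : Subgroup (Y ≃ₜ Y)) (G : C(Z, 𝒢)) : (Z × Y) ≃ₜ (Z × Y) :=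
  Continuous.homeoOfEquivCompactToT2
    (f := { toFun := fun p => (S p.1, (G p.1 : Y ≃ₜ Y) p.2)
            invFun := fun p => (S.symm p.1, (G (S.symm p.1) : Y ≃ₜ Y).symm p.2)
            left_inv := fun p => by simp
            right_inv := fun p => by simp })
    (continuous_skewProduct S 𝒢 G)

/-!
Write `H_z` for a transfer function `H : Z → 𝒢` and `K * H` for the pointwise product. The skew
product of the coboundary of `H` is conjugate to `S × id`: it moves `(z, y)` to
`(S ^ n z, (H_{S ^ n z})⁻¹ (H_z y))` after `n` steps. Two properties of a skew product are expressed
by countably many open conditions on the cocycle: all orbits visit a given open set, and for some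
length `N` any two points of a fiber have orbit segments of length `N` with mean distance less than
`δ` (`FibersCollapse` is this condition for all `δ`). Each condition holds for a dense set of
coboundaries, so a generic cocycle in the closure of the coboundaries has all of them
(`exists_generic_minimal_collapsing`).

*Density.* Replacing `H` by `K * H` changes the coboundary little if `(K_{Sz})⁻¹ * K_z` is uniformly
close to the identity. Both conditions follow if moreover, for every `y`, the point `(K_z)⁻¹ y` lies
in a given small open set `V` for all `z` outside a set of small measure
(`IsMinimalSystem.exists_slow_transfer`). Such a `K` moves slowly along a path in `𝒢` through the
homeomorphisms `h_1, …, h_M` of condition (A) for `V` and stays at each of them on a set of measure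
about `1 / M`. It is a function of a continuous real function on `Z` that changes by at most `1`
under `S` and whose law is spread out: a continuous version of the distance in time to the nearest
visit to a small ball, which goes up and down with slope one between visits that are far apart
(`IsMinimalSystem.exists_slow_spread`). Averages along orbits are controlled by averages over `Z`
through unique ergodicity (`IsUniqueInvariantMeasure.eventually_sum_lt_of_compact`).

*Collapsing fibers give an isomorphic extension.* If the fibers collapse, then for any invariant
measure the `Y`-coordinate is a limit in the mean of functions of the `Z`-coordinate, namely of the
images under `T ^ n` of a horizontal section. Hence the measure is carried by the graph of a
measurable function, the projection is an isomorphism mod null sets, and the invariant measure is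
unique because the mean of two invariant measures is carried by a graph too
(`FibersCollapse.isIsomorphicExtensionVia`).

*The example.* Over an isometric base, collapsing fibers make the skew product Weyl mean
equicontinuous, and points of a fiber are proximal, hence not separated by equicontinuous factors.
So the projection is the maximal equicontinuous factor, and any factor map to the base is constant
on the fibers, which excludes almost one-to-one extensions when `Y` has two points. The base is the
dyadic odometer, and the transfer functions take values in the Möbius group of the circle, for which
condition (A) is the north-south dynamics of hyperbolic transformations
(`conditionA_moebiusGroup`). The cocycles themselves are taken in the group of all homeomorphisms:
being closed, it gives a Baire space of cocycles (`baireSpace_closure_of_isClosed`), so that generic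
cocycles exist.
-/

/-! ### The group of homeomorphisms of a compact metric space -/

theorem dist_homeo_lt_iff {Y : Type*} [MetricSpace Y] [CompactSpace Y] {g h : Y ≃ₜ Y} {ε : ℝ}
    (hε : 0 < ε) : dist g h < ε ↔ ∀ y, dist (g y) (h y) < ε :=
  ContinuousMap.dist_lt_iff (f := (⟨g, g.continuous⟩ : C(Y, Y)))
    (g := (⟨h, h.continuous⟩ : C(Y, Y))) hε

theorem isInducing_homeo_toContinuousMap {Y : Type*} [MetricSpace Y] [CompactSpace Y] :
    IsInducing fun g : Y ≃ₜ Y => (⟨g, g.continuous⟩ : C(Y, Y)) := ⟨rfl⟩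

theorem continuous_homeo_apply {Y : Type*} [MetricSpace Y] [CompactSpace Y] :
    Continuous fun p : (Y ≃ₜ Y) × Y => p.1 p.2 :=
  (isInducing_homeo_toContinuousMap.continuous.comp continuous_fst).eval continuous_snd

/-- A family of homeomorphisms of a compact space is continuous for the uniform metric as soon as
it is jointly continuous. -/
theorem continuous_homeo_of_uncurry {A Y : Type*} [TopologicalSpace A] [MetricSpace Y]
    [CompactSpace Y] {f : A → (Y ≃ₜ Y)} (hf : Continuous fun p : A × Y => f p.1 p.2) :
    Continuous f :=
  isInducing_homeo_toContinuousMap.continuous_iff.2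
    (ContinuousMap.curry ⟨fun p : A × Y => f p.1 p.2, hf⟩).continuous

/-- Inversion of homeomorphisms is jointly continuous: its graph is closed and its values lie in a
compact space. -/
theorem continuous_homeo_inv_apply {Y : Type*} [MetricSpace Y] [CompactSpace Y] :
    Continuous fun p : (Y ≃ₜ Y) × Y => p.1⁻¹ p.2 := by
  refine continuous_iff_isClosed.2 fun C hC => ?_
  have h1 : IsClosed {q : ((Y ≃ₜ Y) × Y) × Y | q.1.1 q.2 = q.1.2 ∧ q.2 ∈ C} :=
    (isClosed_eq (continuous_homeo_apply.comp ((continuous_fst.comp continuous_fst).prodMk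
      continuous_snd)) (continuous_snd.comp continuous_fst)).inter (hC.preimage continuous_snd)
  convert isClosedMap_fst_of_compactSpace _ h1 using 1
  ext ⟨g, y⟩
  constructor
  · intro h
    exact ⟨((g, y), g⁻¹ y), ⟨g.apply_symm_apply y, h⟩, rfl⟩
  · rintro ⟨⟨⟨g', y'⟩, w⟩, ⟨hw, hwC⟩, h⟩
    obtain ⟨rfl, rfl⟩ := Prod.mk.inj h
    have : g'⁻¹ y' = w := by
      rw [← show g' w = y' from hw]
      exact g'.symm_apply_apply w
    change g'⁻¹ y' ∈ C
    rwa [this]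

instance {Y : Type*} [MetricSpace Y] [CompactSpace Y] : IsTopologicalGroup (Y ≃ₜ Y) where
  continuous_mul := by
    refine continuous_homeo_of_uncurry ?_
    exact continuous_homeo_apply.comp ((continuous_fst.comp continuous_fst).prodMk
      (continuous_homeo_apply.comp ((continuous_snd.comp continuous_fst).prodMk continuous_snd)))
  continuous_inv := continuous_homeo_of_uncurry continuous_homeo_inv_apply

/-! ### Skew products -/

theorem zpow_apply_fst_of_semiconj {Z Y : Type*} [TopologicalSpace Z] [TopologicalSpace Y]
    {S : Z ≃ₜ Z} {T : (Z × Y) ≃ₜ (Z × Y)}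
    (hT : ∀ x, (T x).1 = S x.1) (n : ℤ) (x : Z × Y) : ((T ^ n) x).1 = (S ^ n) x.1 := by
  induction n using Int.induction_on generalizing x with
  | zero => rfl
  | succ n ih => rw [zpow_add_one, zpow_add_one]; exact (ih (T x)).trans (by rw [hT]; rfl)
  | pred n ih =>
    rw [zpow_sub_one, zpow_sub_one]
    refine (ih (T⁻¹ x)).trans ?_
    have h : (T⁻¹ x).1 = S⁻¹ x.1 := by
      have h' := hT (T⁻¹ x)
      rw [show T (T⁻¹ x) = x from T.apply_symm_apply x] at h'
      rw [h']
      exact (S.symm_apply_apply _).symm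
    rw [h]; rfl

section SkewProduct

variable {Z Y : Type*} [MetricSpace Z] [CompactSpace Z] [MetricSpace Y] [CompactSpace Y]

theorem continuous_cocycle_apply {𝒢 : Subgroup (Y ≃ₜ Y)} :
    Continuous fun q : C(Z, 𝒢) × Z × Y => (q.1 q.2.1 : Y ≃ₜ Y) q.2.2 := by
  have h : Continuous fun q : C(Z, 𝒢) × Z × Y => q.1 q.2.1 :=
    continuous_fst.eval (continuous_fst.comp continuous_snd)
  exact continuous_homeo_apply.comp ((continuous_subtype_val.comp h).prodMk
    (continuous_snd.comp continuous_snd))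

theorem continuous_cocycle_inv_apply {𝒢 : Subgroup (Y ≃ₜ Y)} :
    Continuous fun q : C(Z, 𝒢) × Z × Y => (q.1 q.2.1 : Y ≃ₜ Y)⁻¹ q.2.2 := by
  have h : Continuous fun q : C(Z, 𝒢) × Z × Y => q.1 q.2.1 :=
    continuous_fst.eval (continuous_fst.comp continuous_snd)
  exact continuous_homeo_inv_apply.comp ((continuous_subtype_val.comp h).prodMk
    (continuous_snd.comp continuous_snd))

variable (S : Z ≃ₜ Z) (𝒢 : Subgroup (Y ≃ₜ Y))

/-- The powers of a skew product depend jointly continuously on the cocycle and the point. -/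
theorem continuous_skewProduct_zpow (n : ℤ) :
    Continuous fun q : C(Z, 𝒢) × Z × Y => (skewProduct S 𝒢 q.1 ^ n) q.2 := by
  have h1 : Continuous fun q : C(Z, 𝒢) × Z × Y => skewProduct S 𝒢 q.1 q.2 :=
    (S.continuous.comp (continuous_fst.comp continuous_snd)).prodMk continuous_cocycle_apply
  have h2 : Continuous fun q : C(Z, 𝒢) × Z × Y => (skewProduct S 𝒢 q.1)⁻¹ q.2 := by
    have hS : Continuous fun q : C(Z, 𝒢) × Z × Y => S⁻¹ q.2.1 :=
      S⁻¹.continuous.comp (continuous_fst.comp continuous_snd)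
    exact hS.prodMk (continuous_cocycle_inv_apply.comp (continuous_fst.prodMk
      (hS.prodMk (continuous_snd.comp continuous_snd))))
  induction n using Int.induction_on with
  | zero =>
    simp only [zpow_zero]
    exact continuous_snd (X := C(Z, 𝒢)) (Y := Z × Y)
  | succ n ih =>
    simp only [zpow_add_one]
    exact ih.comp (continuous_fst.prodMk h1)
  | pred n ih =>
    simp only [zpow_sub_one]
    exact ih.comp (continuous_fst.prodMk h2)

/-- A coboundary `z ↦ (H (S z))⁻¹ * H z` makes the skew product conjugate to `S × id`. -/
theorem skewProduct_zpow_apply_of_coboundary {G : C(Z, 𝒢)} {H : Z → (Y ≃ₜ Y)}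
    (hG : ∀ z, (G z : Y ≃ₜ Y) = (H (S z))⁻¹ * H z) (n : ℤ) (z : Z) (y : Y) :
    (skewProduct S 𝒢 G ^ n) (z, y) = ((S ^ n) z, (H ((S ^ n) z))⁻¹ (H z y)) := by
  have hinv : ∀ (g : Y ≃ₜ Y) (w : Y), g⁻¹ (g w) = w := fun g w => g.symm_apply_apply w
  have hinv' : ∀ (g : Y ≃ₜ Y) (w : Y), g (g⁻¹ w) = w := fun g w => g.apply_symm_apply w
  induction n using Int.induction_on generalizing z y with
  | zero => simp [hinv]
  | succ n ih =>
    rw [zpow_add_one, zpow_add_one]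
    refine (ih (S z) ((G z : Y ≃ₜ Y) y)).trans ?_
    simp [hG]
  | pred n ih =>
    rw [zpow_sub_one, zpow_sub_one]
    refine (ih (S⁻¹ z) ((G (S⁻¹ z) : Y ≃ₜ Y)⁻¹ y)).trans ?_
    simp only [hG, Homeomorph.mul_apply, mul_inv_rev, inv_inv]
    rw [show S (S⁻¹ z) = z from S.apply_symm_apply z]
    simp

end SkewProduct

/-! ### Empirical measures and unique ergodicity -/

theorem measurePreserving_homeo_pow {X : Type*} [TopologicalSpace X] [MeasurableSpace X]
    {T : X ≃ₜ X} {μ : Measure X}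
    (h : MeasurePreserving T μ μ)
    (n : ℕ) : MeasurePreserving (T ^ n : X ≃ₜ X) μ μ := by
  induction n with
  | zero => exact MeasurePreserving.id μ
  | succ n ih => rw [pow_succ]; exact ih.comp h

section Empirical

variable {X : Type*} [MetricSpace X] [CompactSpace X] [MeasurableSpace X] [BorelSpace X]

/-- The empirical measure of the orbit segment `x, T x, …, T ^ N x` (of length `N + 1`, so that it
is always a probability measure). -/
noncomputable def empiricalMeasure (T : X ≃ₜ X) (N : ℕ) (x : X) : ProbabilityMeasure X :=
  ⟨((N + 1 : ℕ) : ENNReal)⁻¹ • ∑ n ∈ Finset.range (N + 1), Measure.dirac ((T ^ n) x), ⟨by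
    simp only [Measure.smul_apply, Measure.finsetSum_apply, measure_univ, Finset.sum_const,
      Finset.card_range, nsmul_eq_mul, mul_one, smul_eq_mul]
    exact ENNReal.inv_mul_cancel (by simp) (ENNReal.natCast_ne_top _)⟩⟩

theorem integral_empiricalMeasure (T : X ≃ₜ X) (N : ℕ) (x : X) (f : C(X, ℝ)) :
    ∫ w, f w ∂(empiricalMeasure T N x : Measure X) =
      (∑ n ∈ Finset.range (N + 1), f ((T ^ n) x)) / ((N + 1 : ℕ) : ℝ) := by
  change ∫ w, f w ∂(((N + 1 : ℕ) : ENNReal)⁻¹ •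
    ∑ n ∈ Finset.range (N + 1), Measure.dirac ((T ^ n) x)) = _
  rw [integral_smul_measure, integral_finsetSum_measure]
  · simp only [integral_dirac, ENNReal.toReal_inv, ENNReal.toReal_natCast, smul_eq_mul]
    field_simp
  · intro n _
    exact integrable_dirac (by simp)

theorem continuousMap_integrable (μ : Measure X) [IsFiniteMeasure μ] (f : C(X, ℝ)) :
    Integrable f μ :=
  BoundedContinuousFunction.integrable μ (BoundedContinuousFunction.mkOfCompact f)

/-- **Krylov–Bogolyubov**: limits of empirical measures along orbit segments whose lengths tend to
infinity are invariant. -/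
theorem exists_invariant_of_averages (T : X ≃ₜ X) (x : ℕ → X) {N : ℕ → ℕ}
    (hN : Tendsto N atTop atTop) :
    ∃ μ : ProbabilityMeasure X, MeasurePreserving T (μ : Measure X) (μ : Measure X) ∧
      ∀ (f : C(X, ℝ)) (c : ℝ),
        (∀ k, c ≤ (∑ n ∈ Finset.range (N k + 1), f ((T ^ n) (x k))) / ((N k + 1 : ℕ) : ℝ)) →
          c ≤ ∫ w, f w ∂(μ : Measure X) := by
  let 𝒰 : Ultrafilter ℕ := hyperfilter ℕ
  obtain ⟨μ, -, hμ⟩ := (isCompact_univ (X := ProbabilityMeasure X)).ultrafilter_le_nhds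
    (𝒰.map fun k => empiricalMeasure T (N k) (x k)) (by simp)
  have hlim : Tendsto (fun k => empiricalMeasure T (N k) (x k)) 𝒰 (𝓝 μ) := hμ
  have hint : ∀ f : C(X, ℝ), Tendsto (fun k =>
      (∑ n ∈ Finset.range (N k + 1), f ((T ^ n) (x k))) / ((N k + 1 : ℕ) : ℝ)) 𝒰
      (𝓝 (∫ w, f w ∂(μ : Measure X))) := by
    intro f
    have h := (ProbabilityMeasure.tendsto_iff_forall_integral_tendsto.1 hlim)
      (BoundedContinuousFunction.mkOfCompact f)
    refine h.congr fun k => ?_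
    exact integral_empiricalMeasure T (N k) (x k) f
  refine ⟨μ, ⟨T.continuous.measurable, ?_⟩, fun f c hc => ge_of_tendsto' (hint f) hc⟩
  have hmap : IsProbabilityMeasure (Measure.map T (μ : Measure X)) :=
    Measure.isProbabilityMeasure_map T.continuous.aemeasurable
  refine ext_of_forall_integral_eq_of_IsFiniteMeasure fun f => ?_
  rw [integral_map T.continuous.aemeasurable (by fun_prop)]
  -- the averages of `f ∘ T` and of `f` over a long segment differ only by two boundary terms
  let g : C(X, ℝ) := f.toContinuousMap
  have h1 := (hint (g.comp ⟨T, T.continuous⟩)).sub (hint g)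
  have h2 : Tendsto (fun k => 2 * ‖f‖ / ((N k + 1 : ℕ) : ℝ)) 𝒰 (𝓝 0) := by
    have : Tendsto (fun k => ((N k + 1 : ℕ) : ℝ)) atTop atTop :=
      tendsto_natCast_atTop_atTop.comp ((tendsto_add_atTop_nat 1).comp hN)
    exact (this.const_div_atTop _).mono_left Nat.hyperfilter_le_atTop
  have h3 := squeeze_zero_norm (fun k => ?_) h2 (f := fun k =>
      (∑ n ∈ Finset.range (N k + 1), (g.comp ⟨T, T.continuous⟩) ((T ^ n) (x k))) /
        ((N k + 1 : ℕ) : ℝ) -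
      (∑ n ∈ Finset.range (N k + 1), g ((T ^ n) (x k))) / ((N k + 1 : ℕ) : ℝ))
  · exact sub_eq_zero.1 (tendsto_nhds_unique h1 h3)
  · have hs : ∑ n ∈ Finset.range (N k + 1), (g.comp ⟨T, T.continuous⟩) ((T ^ n) (x k)) =
        ∑ n ∈ Finset.range (N k + 1), g ((T ^ (n + 1)) (x k)) := by
      refine Finset.sum_congr rfl fun n _ => ?_
      rw [pow_succ']; rfl
    rw [hs, ← sub_div, ← Finset.sum_sub_distrib,
      Finset.sum_range_sub fun n => g ((T ^ n) (x k)), norm_div, Real.norm_natCast]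
    gcongr
    refine (norm_sub_le _ _).trans ?_
    have := f.norm_coe_le_norm ((T ^ (N k + 1)) (x k))
    have := f.norm_coe_le_norm ((T ^ 0) (x k))
    change ‖f ((T ^ (N k + 1)) (x k))‖ + ‖f ((T ^ 0) (x k))‖ ≤ _
    linarith

/-- In a uniquely ergodic system the Birkhoff averages of a continuous function are uniformly
bounded by any number above its mean. -/
theorem IsUniqueInvariantMeasure.eventually_sum_lt {T : X ≃ₜ X} {μ : ProbabilityMeasure X}
    (hT : IsUniqueInvariantMeasure T μ) (f : C(X, ℝ)) {c : ℝ}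
    (hc : ∫ x, f x ∂(μ : Measure X) < c) :
    ∀ᶠ N : ℕ in atTop, ∀ x, ∑ n ∈ Finset.range (N + 1), f ((T ^ n) x) < c * ((N + 1 : ℕ) : ℝ) := by
  by_contra hcon
  obtain ⟨N, hN, hx⟩ := extraction_of_frequently_atTop (not_eventually.1 hcon)
  push Not at hx
  choose x hx using hx
  obtain ⟨μ', hμ', h⟩ := exists_invariant_of_averages T x hN.tendsto_atTop
  rw [(hT μ').1 hμ'] at h
  refine absurd (h f c fun k => ?_) (not_le.2 hc)
  rw [le_div_iff₀ (by positivity)]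
  exact hx k

/-- Unique ergodicity gives Birkhoff averages that are uniform over a compact set of parameters
too. -/
theorem IsUniqueInvariantMeasure.eventually_sum_lt_of_compact {P : Type*} [TopologicalSpace P]
    [CompactSpace P] {T : X ≃ₜ X} {μ : ProbabilityMeasure X}
    (hT : IsUniqueInvariantMeasure T μ) (F : C(P, C(X, ℝ))) {c : ℝ}
    (hc : ∀ p, ∫ x, F p x ∂(μ : Measure X) < c) :
    ∀ᶠ N : ℕ in atTop, ∀ p x,
      ∑ n ∈ Finset.range (N + 1), F p ((T ^ n) x) < c * ((N + 1 : ℕ) : ℝ) := by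
  have key := isCompact_univ.induction_on (X := P)
    (p := fun s => ∀ᶠ N : ℕ in atTop, ∀ p ∈ s, ∀ x,
      ∑ n ∈ Finset.range (N + 1), F p ((T ^ n) x) < c * ((N + 1 : ℕ) : ℝ))
    (by simp) (fun s t hst ht => ht.mono fun N h p hp => h p (hst hp))
    (fun s t hs ht => by
      filter_upwards [hs, ht] with N h1 h2 p hp
      exact hp.elim (h1 p) (h2 p)) ?_
  · exact key.mono fun N h p => h p (Set.mem_univ p)
  · intro p _
    obtain ⟨c', hc1, hc2⟩ := exists_between (hc p)
    refine ⟨{q | dist (F q) (F p) < c - c'}, ?_, ?_⟩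
    · refine mem_nhdsWithin_of_mem_nhds ?_
      exact F.continuous.continuousAt.eventually (Metric.ball_mem_nhds _ (sub_pos.2 hc2))
    · filter_upwards [hT.eventually_sum_lt (F p) hc1] with N hN q hq x
      have h1 : ∑ n ∈ Finset.range (N + 1), F q ((T ^ n) x) ≤
          ∑ n ∈ Finset.range (N + 1), (F p ((T ^ n) x) + (c - c')) := by
        refine Finset.sum_le_sum fun n _ => ?_
        have h2 := (ContinuousMap.dist_apply_le_dist (f := F q) (g := F p) ((T ^ n) x)).trans
          (le_of_lt hq)
        rw [Real.dist_eq] at h2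
        linarith [le_abs_self (F q ((T ^ n) x) - F p ((T ^ n) x))]
      rw [Finset.sum_add_distrib, Finset.sum_const, Finset.card_range, nsmul_eq_mul] at h1
      nlinarith [hN x]

end Empirical

/-! ### Skew products with collapsing fibers -/

theorem map_graph_eq_of_ae {Z Y : Type*} [MeasurableSpace Z] [MeasurableSpace Y]
    {μ : Measure (Z × Y)} {φ : Z → Y}
    (hφ : Measurable φ)
    (h : ∀ᵐ x ∂μ, φ x.1 = x.2) :
    Measure.map (fun z => (z, φ z)) (Measure.map Prod.fst μ) = μ := by
  rw [Measure.map_map (by fun_prop) measurable_fst]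
  conv_rhs => rw [← Measure.map_id (μ := μ)]
  refine Measure.map_congr ?_
  filter_upwards [h] with x hx
  exact Prod.ext rfl hx

theorem map_fst_eq_of_invariant {Z Y : Type*} [TopologicalSpace Z] [MeasurableSpace Z]
    [BorelSpace Z] [TopologicalSpace Y] [MeasurableSpace Y] {S : Z ≃ₜ Z} {ν : ProbabilityMeasure Z}
    (hS : IsUniqueInvariantMeasure S ν) {T : (Z × Y) ≃ₜ (Z × Y)} (hT : ∀ x, (T x).1 = S x.1)
    (μ : ProbabilityMeasure (Z × Y)) (hμ : MeasurePreserving T (μ : Measure (Z × Y)) μ) :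
    Measure.map Prod.fst (μ : Measure (Z × Y)) = ν := by
  have h := (hS (μ.map measurable_fst.aemeasurable)).1 ⟨S.continuous.measurable, ?_⟩
  · exact congrArg (fun m : ProbabilityMeasure Z => (m : Measure Z)) h
  · change Measure.map S (Measure.map Prod.fst (μ : Measure (Z × Y))) =
      Measure.map Prod.fst (μ : Measure (Z × Y))
    rw [Measure.map_map S.continuous.measurable measurable_fst]
    conv_rhs => rw [← hμ.map_eq, Measure.map_map measurable_fst hμ.measurable]
    congr 1
    funext x
    exact (hT x).symm

section FibersCollapse

variable {Z Y : Type*} [MetricSpace Z] [CompactSpace Z] [MetricSpace Y] [CompactSpace Y]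

/-- The fibers of `Z × Y → Z` collapse on average under `T`: for every `δ > 0` there is a length
`N + 1` such that any two points of any fiber have orbit segments of that length whose
`Y`-coordinates are at mean distance less than `δ`. -/
def FibersCollapse (T : (Z × Y) ≃ₜ (Z × Y)) : Prop :=
  ∀ δ : ℝ, 0 < δ → ∃ N : ℕ, ∀ (z : Z) (y y' : Y),
    ∑ n ∈ Finset.range (N + 1), dist ((T ^ n) (z, y)).2 ((T ^ n) (z, y')).2 < δ * ((N + 1 : ℕ) : ℝ)

variable [MeasurableSpace Z] [BorelSpace Z] [MeasurableSpace Y] [BorelSpace Y]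

/-- If the fibers collapse then, for any invariant measure, the `Y`-coordinate is approximated in
the mean by continuous functions of the `Z`-coordinate, namely by the images under `T ^ n` of a
horizontal section. -/
theorem FibersCollapse.exists_continuous_integral_dist_lt [Nonempty Y] {S : Z ≃ₜ Z}
    {T : (Z × Y) ≃ₜ (Z × Y)} (hT : ∀ x, (T x).1 = S x.1) (hc : FibersCollapse T)
    (μ : ProbabilityMeasure (Z × Y)) (hμ : MeasurePreserving T (μ : Measure (Z × Y)) μ) {δ : ℝ}
    (hδ : 0 < δ) :
    ∃ φ : C(Z, Y), ∫ x, dist x.2 (φ x.1) ∂(μ : Measure (Z × Y)) < δ := by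
  obtain ⟨N, hN⟩ := hc δ hδ
  obtain ⟨y₀⟩ := ‹Nonempty Y›
  let φ : ℕ → C(Z, Y) := fun n => ⟨fun z => ((T ^ n) ((S ^ n)⁻¹ z, y₀)).2, by fun_prop⟩
  have hfst : ∀ n x, ((T ^ n) x).1 = (S ^ n) x.1 := fun n x =>
    zpow_apply_fst_of_semiconj hT n x
  have hshift : ∀ n, ∫ x, dist ((T ^ n) x).2 ((T ^ n) (x.1, y₀)).2 ∂(μ : Measure (Z × Y)) =
      ∫ x, dist x.2 (φ n x.1) ∂(μ : Measure (Z × Y)) := by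
    intro n
    rw [← (measurePreserving_homeo_pow hμ n).integral_comp (T ^ n).measurableEmbedding
      fun x : Z × Y => dist x.2 (φ n x.1)]
    refine integral_congr_ae (Eventually.of_forall fun x => ?_)
    change _ = dist ((T ^ n) x).2 ((T ^ n) ((S ^ n)⁻¹ ((T ^ n) x).1, y₀)).2
    rw [hfst, show (S ^ n)⁻¹ ((S ^ n) x.1) = x.1 from (S ^ n).symm_apply_apply _]
  have hint : ∀ n, Integrable (fun x : Z × Y => dist ((T ^ n) x).2 ((T ^ n) (x.1, y₀)).2)
      (μ : Measure (Z × Y)) := fun n =>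
    continuousMap_integrable (μ : Measure (Z × Y))
      ⟨fun x : Z × Y => dist ((T ^ n) x).2 ((T ^ n) (x.1, y₀)).2, by fun_prop⟩
  by_contra! hcon
  have h1 : ∑ n ∈ Finset.range (N + 1), ∫ x, dist x.2 (φ n x.1) ∂(μ : Measure (Z × Y)) <
      δ * ((N + 1 : ℕ) : ℝ) := by
    simp_rw [← hshift]
    rw [← integral_finsetSum _ fun n _ => hint n]
    obtain ⟨x₀, -, hx₀⟩ := isCompact_univ.exists_isMaxOn
      (Set.nonempty_iff_univ_nonempty.1 μ.nonempty)
      (f := fun x : Z × Y => ∑ n ∈ Finset.range (N + 1),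
        dist ((T ^ n) x).2 ((T ^ n) (x.1, y₀)).2) (by fun_prop)
    refine lt_of_le_of_lt ?_ (hN x₀.1 x₀.2 y₀)
    refine (integral_mono (integrable_finsetSum _ fun n _ => hint n) (integrable_const _)
      fun x => hx₀ (Set.mem_univ x)).trans ?_
    simp
  have h2 : ∑ n ∈ Finset.range (N + 1), δ ≤
      ∑ n ∈ Finset.range (N + 1), ∫ x, dist x.2 (φ n x.1) ∂(μ : Measure (Z × Y)) :=
    Finset.sum_le_sum fun n _ => hcon (φ n)
  rw [Finset.sum_const, Finset.card_range, nsmul_eq_mul, mul_comm] at h2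
  linarith

/-- If the fibers collapse, every invariant measure lives on the graph of a measurable function. -/
theorem FibersCollapse.exists_measurable_graph [Nonempty Y] {S : Z ≃ₜ Z}
    {T : (Z × Y) ≃ₜ (Z × Y)} (hT : ∀ x, (T x).1 = S x.1) (hc : FibersCollapse T)
    (μ : ProbabilityMeasure (Z × Y)) (hμ : MeasurePreserving T (μ : Measure (Z × Y)) μ) :
    ∃ φ : Z → Y, Measurable φ ∧ ∀ᵐ x ∂(μ : Measure (Z × Y)), φ x.1 = x.2 := by
  choose φ hφ using fun k : ℕ => hc.exists_continuous_integral_dist_lt hT μ hμ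
    (δ := (1 / 2 : ℝ) ^ k) (by positivity)
  have hcont : ∀ k, Continuous fun x : Z × Y => dist x.2 (φ k x.1) := fun k => by fun_prop
  have hlim : ∀ᵐ x ∂(μ : Measure (Z × Y)), Tendsto (fun k => φ k x.1) atTop (𝓝 x.2) := by
    have h1 : ∫⁻ x, ∑' k, ENNReal.ofReal (dist x.2 (φ k x.1)) ∂(μ : Measure (Z × Y)) ≠ ⊤ := by
      rw [lintegral_tsum fun k => (hcont k).measurable.ennreal_ofReal.aemeasurable]
      refine ne_top_of_le_ne_top ?_ (ENNReal.tsum_le_tsum (g := fun k =>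
        ENNReal.ofReal ((1 / 2 : ℝ) ^ k)) fun k => ?_)
      · rw [← ENNReal.ofReal_tsum_of_nonneg (fun k => by positivity) summable_geometric_two]
        exact ENNReal.ofReal_ne_top
      · have hi : Integrable (fun x : Z × Y => dist x.2 (φ k x.1)) (μ : Measure (Z × Y)) :=
          continuousMap_integrable (μ : Measure (Z × Y)) ⟨_, hcont k⟩
        rw [← ofReal_integral_eq_lintegral_ofReal hi
          (Eventually.of_forall fun x => dist_nonneg)]
        exact ENNReal.ofReal_le_ofReal (hφ k).le
    filter_upwards [ae_lt_top' (by fun_prop) h1] with x hx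
    have h2 := ENNReal.tendsto_atTop_zero_of_tsum_ne_top hx.ne
    rw [tendsto_iff_dist_tendsto_zero]
    have h3 := (ENNReal.tendsto_toReal ENNReal.zero_ne_top).comp h2
    simpa [Function.comp_def, dist_comm, ENNReal.toReal_ofReal dist_nonneg] using h3
  have hmap : ∀ᵐ z ∂(Measure.map Prod.fst (μ : Measure (Z × Y))),
      ∃ y, Tendsto (fun k => φ k z) atTop (𝓝 y) := by
    rw [ae_map_iff measurable_fst.aemeasurable
      (MeasureTheory.measurableSet_exists_tendsto fun k => (φ k).continuous.measurable)]
    exact hlim.mono fun x hx => ⟨_, hx⟩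
  obtain ⟨ψ, hψm, hψ⟩ := measurable_limit_of_tendsto_metrizable_ae
    (fun k => (φ k).continuous.measurable.aemeasurable) hmap
  refine ⟨ψ, hψm, ?_⟩
  filter_upwards [hlim, ae_of_ae_map measurable_fst.aemeasurable hψ] with x h1 h2
  exact tendsto_nhds_unique h2 h1

/-- A skew product with collapsing fibers is an isomorphic extension of its base. Two invariant
measures coincide because their mean is also carried by a graph, so that both are the lift of the
base measure to this graph. -/
theorem FibersCollapse.isIsomorphicExtensionVia [Nonempty Y] {S : Z ≃ₜ Z}
    (hS : IsUniquelyErgodic S) {T : (Z × Y) ≃ₜ (Z × Y)} (hT : ∀ x, (T x).1 = S x.1)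
    (hc : FibersCollapse T) : IsIsomorphicExtensionVia T S Prod.fst := by
  obtain ⟨ν, hν⟩ := hS
  have hZ : Nonempty Z := ν.nonempty
  obtain ⟨μ, hμ, -⟩ := exists_invariant_of_averages T (fun _ => Classical.arbitrary (Z × Y))
    tendsto_id
  refine ⟨⟨continuous_fst, Prod.fst_surjective, hT⟩, μ, ν, fun μ' => ⟨fun hμ' => ?_, ?_⟩, hν, ?_⟩
  · have hmean : IsProbabilityMeasure
        ((2 : ENNReal)⁻¹ • ((μ' : Measure (Z × Y)) + (μ : Measure (Z × Y)))) := ⟨by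
      simp only [Measure.smul_apply, Measure.add_apply, measure_univ, smul_eq_mul]
      rw [one_add_one_eq_two]
      exact ENNReal.inv_mul_cancel (by simp) (by simp)⟩
    have hinv : MeasurePreserving T
        ((2 : ENNReal)⁻¹ • ((μ' : Measure (Z × Y)) + (μ : Measure (Z × Y))))
        ((2 : ENNReal)⁻¹ • ((μ' : Measure (Z × Y)) + (μ : Measure (Z × Y)))) :=
      ⟨T.continuous.measurable, by
        rw [Measure.map_smul, Measure.map_add _ _ T.continuous.measurable, hμ.map_eq, hμ'.map_eq]⟩
    obtain ⟨φ, hφm, hφ⟩ := hc.exists_measurable_graph hT ⟨_, hmean⟩ hinv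
    change ∀ᵐ x ∂((2 : ENNReal)⁻¹ • ((μ' : Measure (Z × Y)) + (μ : Measure (Z × Y)))),
      φ x.1 = x.2 at hφ
    rw [Measure.ae_ennreal_smul_measure_iff (by simp), ae_add_measure_iff] at hφ
    have h1 := map_graph_eq_of_ae hφm hφ.1
    have h2 := map_graph_eq_of_ae hφm hφ.2
    rw [map_fst_eq_of_invariant hν hT _ ‹_›] at h1 h2
    exact Subtype.ext (h1.symm.trans h2)
  · rintro rfl
    exact hμ
  · obtain ⟨φ, hφm, hφ⟩ := hc.exists_measurable_graph hT μ hμ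
    have h1 := map_fst_eq_of_invariant hν hT μ hμ
    have h2 := map_graph_eq_of_ae hφm hφ
    rw [h1] at h2
    refine ⟨⟨measurable_fst, h1⟩, fun z => (z, φ z), ⟨by fun_prop, h2⟩, ?_, ?_⟩
    · filter_upwards [hφ] with x hx
      exact Prod.ext rfl hx
    · exact Eventually.of_forall fun z => rfl

end FibersCollapse

/-! ### Minimal systems and slowly varying functions -/

section Minimal

variable {Z : Type*} [MetricSpace Z] [CompactSpace Z] {S : Z ≃ₜ Z}

theorem IsMinimalSystem.exists_zpow_mem {Z : Type*} [TopologicalSpace Z] {S : Z ≃ₜ Z}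
    (hS : IsMinimalSystem S) {O : Set Z} (hO : IsOpen O) (hne : O.Nonempty) (z : Z) :
    ∃ n : ℤ, (S ^ n) z ∈ O := by
  obtain ⟨_, ⟨n, rfl⟩, hw⟩ := (hS z).exists_mem_open hO hne
  exact ⟨n, hw⟩

theorem IsMinimalSystem.exists_bound_zpow_mem (hS : IsMinimalSystem S) {O : Set Z}
    (hO : IsOpen O) (hne : O.Nonempty) :
    ∃ N : ℕ, ∀ z, ∃ n : ℤ, |n| ≤ N ∧ (S ^ n) z ∈ O := by
  obtain ⟨N, hN⟩ := isCompact_univ.elim_directed_cover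
    (fun N : ℕ => ⋃ n ∈ {n : ℤ | |n| ≤ N}, (S ^ n) ⁻¹' O)
    (fun N => isOpen_biUnion fun n _ => hO.preimage (S ^ n).continuous)
    (fun z _ => by
      obtain ⟨n, hn⟩ := hS.exists_zpow_mem hO hne z
      exact Set.mem_iUnion.2 ⟨n.natAbs, Set.mem_biUnion (by simp) hn⟩)
    (directed_of_isDirected_le fun a b hab =>
      Set.biUnion_subset_biUnion_left fun n (hn : |n| ≤ a) =>
        hn.trans (by exact_mod_cast hab))
  refine ⟨N, fun z => ?_⟩
  obtain ⟨n, hn, h⟩ := Set.mem_iUnion₂.1 (hN (Set.mem_univ z))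
  exact ⟨n, hn, h⟩

theorem IsMinimalSystem.zpow_apply_ne {Z : Type*} [TopologicalSpace Z] [T1Space Z] [Infinite Z]
    {S : Z ≃ₜ Z} (hS : IsMinimalSystem S) (z : Z) {n : ℤ} (hn : 0 < n) : (S ^ n) z ≠ z := by
  intro h
  have hper : ∀ q : ℤ, (S ^ (n * q)) z = z := by
    have h' : (S ^ n)⁻¹ z = z := by
      conv_lhs => rw [← h]
      exact (S ^ n).symm_apply_apply z
    intro q
    rw [zpow_mul]
    induction q using Int.induction_on with
    | zero => rfl
    | succ q ih => rw [zpow_add_one]; change ((S ^ n) ^ (q : ℤ)) ((S ^ n) z) = z; rwa [h]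
    | pred q ih => rw [zpow_sub_one]; change ((S ^ n) ^ (-q : ℤ)) ((S ^ n)⁻¹ z) = z; rwa [h']
  have hfin : (Set.range fun k : ℤ => (S ^ k) z).Finite := by
    refine ((Set.finite_Ico (0 : ℤ) n).image fun k => (S ^ k) z).subset ?_
    rintro _ ⟨k, rfl⟩
    refine ⟨k % n, ⟨Int.emod_nonneg k hn.ne', Int.emod_lt_of_pos k hn⟩, ?_⟩
    have hk : (S ^ k) z = (S ^ (k % n)) ((S ^ (n * (k / n))) z) := by
      rw [← Homeomorph.mul_apply, ← zpow_add, Int.emod_add_mul_ediv]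
    rw [hper] at hk
    exact hk.symm
  have huniv := (hS z).closure_eq
  rw [hfin.isClosed.closure_eq] at huniv
  exact Set.infinite_univ (huniv ▸ hfin)

/-- In an infinite minimal system, small balls have large return times. -/
theorem IsMinimalSystem.exists_radius_return {Z : Type*} [MetricSpace Z] [Infinite Z]
    {S : Z ≃ₜ Z} (hS : IsMinimalSystem S) (z₀ : Z) (R : ℕ) :
    ∃ r > 0, ∀ z, dist z z₀ < r → ∀ n : ℤ, 0 < n → n ≤ R → r ≤ dist ((S ^ n) z) z₀ := by
  have h : ∀ n ∈ Finset.Ioc (0 : ℤ) R, ∀ᶠ r in 𝓝[>] (0 : ℝ),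
      ∀ z, dist z z₀ < r → r ≤ dist ((S ^ n) z) z₀ := by
    intro n hn
    have hd : 0 < dist ((S ^ n) z₀) z₀ :=
      dist_pos.2 (hS.zpow_apply_ne z₀ (Finset.mem_Ioc.1 hn).1)
    have hcont : Continuous fun z => dist ((S ^ n) z) z₀ := by fun_prop
    obtain ⟨ρ, hρ, hball⟩ := Metric.eventually_nhds_iff.1
      (hcont.continuousAt.eventually (lt_mem_nhds (half_lt_self hd)))
    filter_upwards [Ioo_mem_nhdsGT hρ, Ioo_mem_nhdsGT (half_pos hd)] with r h1 h2 z hz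
    exact h2.2.le.trans (hball (hz.trans h1.2)).le
  obtain ⟨r, hr, hr0⟩ := (((Filter.eventually_all_finset _).2 h).and self_mem_nhdsWithin).exists
  exact ⟨r, hr0, fun z hz n h0 hn => hr n (Finset.mem_Ioc.2 ⟨h0, hn⟩) z hz⟩

/-- A continuous substitute for the distance in time to the nearest visit to a ball: it is
`1`-Lipschitz along orbits and equal, at each point, to the time distance to a suitable visit plus
the value there. -/
theorem IsMinimalSystem.exists_visit_cost (hS : IsMinimalSystem S) (z₀ : Z) {r : ℝ} (hr : 0 < r) :
    ∃ D : C(Z, ℝ), (∀ z, 0 ≤ D z) ∧ (∀ (z : Z) (n : ℤ), D z ≤ |(n : ℝ)| + D ((S ^ n) z)) ∧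
      ∀ z, ∃ n : ℤ, dist ((S ^ n) z) z₀ < r ∧ D z = |(n : ℝ)| + D ((S ^ n) z) := by
  obtain ⟨N, hN⟩ := hS.exists_bound_zpow_mem (Metric.isOpen_ball (x := z₀) (ε := r / 2))
    ⟨z₀, Metric.mem_ball_self (half_pos hr)⟩
  -- the slope `l` is so large that visiting the ball of radius `r / 2` within time `N` is cheaper
  -- than staying out of the ball of radius `r`
  obtain ⟨l, hl⟩ := exists_nat_gt (2 * N / r)
  have hl0 : 0 ≤ (l : ℝ) := Nat.cast_nonneg l
  have hlr : N + l * (r / 2) < l * r := by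
    rw [div_lt_iff₀ hr] at hl
    linarith
  obtain ⟨B, hB⟩ := exists_nat_gt ((l : ℝ) * r)
  have hNB : N ≤ B := by
    have : (N : ℝ) ≤ B := by nlinarith
    exact_mod_cast this
  let c : ℤ → Z → ℝ := fun n z => |(n : ℝ)| + l * dist ((S ^ n) z) z₀
  have hne : (Finset.Icc (-(B : ℤ)) B).Nonempty := ⟨0, by simp⟩
  let D : C(Z, ℝ) := ⟨fun z => (Finset.Icc (-(B : ℤ)) B).inf' hne fun n => c n z,
    Continuous.finset_inf'_apply hne fun n _ => by
      change Continuous fun z => |(n : ℝ)| + l * dist ((S ^ n) z) z₀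
      fun_prop⟩
  have hmin : ∀ z, ∃ n : ℤ, D z = c n z := fun z => by
    obtain ⟨n, -, hn⟩ := Finset.exists_mem_eq_inf' hne fun n => c n z
    exact ⟨n, hn⟩
  have hDc : ∀ z, ∀ n ∈ Finset.Icc (-(B : ℤ)) B, D z ≤ c n z := fun z n hn =>
    Finset.inf'_le (fun n => c n z) hn
  have hlt : ∀ z, D z < l * r := by
    intro z
    obtain ⟨n, hn, hz⟩ := hN z
    have hnN : |(n : ℝ)| ≤ N := by exact_mod_cast hn
    refine (hDc z n ?_).trans_lt (lt_of_le_of_lt ?_ hlr)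
    · rw [Finset.mem_Icc, ← abs_le]
      exact hn.trans (by exact_mod_cast hNB)
    · exact add_le_add hnN (mul_le_mul_of_nonneg_left (le_of_lt hz) hl0)
  have hle : ∀ z n, D z ≤ c n z := by
    intro z n
    by_cases hn : n ∈ Finset.Icc (-(B : ℤ)) B
    · exact hDc z n hn
    · rw [Finset.mem_Icc, ← abs_le, not_le] at hn
      have hnB : (B : ℝ) < |(n : ℝ)| := by exact_mod_cast hn
      have : 0 ≤ l * dist ((S ^ n) z) z₀ := by positivity
      have h1 := hlt z
      change D z ≤ |(n : ℝ)| + l * dist ((S ^ n) z) z₀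
      linarith
  have hnonneg : ∀ z, 0 ≤ D z := fun z => by
    obtain ⟨n, hn⟩ := hmin z
    rw [hn]
    change 0 ≤ |(n : ℝ)| + l * dist ((S ^ n) z) z₀
    positivity
  have hlip : ∀ (z : Z) (n : ℤ), D z ≤ |(n : ℝ)| + D ((S ^ n) z) := by
    intro z n
    obtain ⟨m, hm⟩ := hmin ((S ^ n) z)
    rw [hm]
    refine (hle z (m + n)).trans ?_
    change |((m + n : ℤ) : ℝ)| + l * dist ((S ^ (m + n)) z) z₀ ≤
      |(n : ℝ)| + (|(m : ℝ)| + l * dist ((S ^ m) ((S ^ n) z)) z₀)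
    rw [zpow_add, Int.cast_add]
    have := abs_add_le (m : ℝ) n
    change |(m : ℝ) + n| + l * dist ((S ^ m) ((S ^ n) z)) z₀ ≤ _
    linarith
  refine ⟨D, hnonneg, hlip, fun z => ?_⟩
  obtain ⟨n, hn⟩ := hmin z
  have hn' : D z = |(n : ℝ)| + l * dist ((S ^ n) z) z₀ := hn
  refine ⟨n, ?_, le_antisymm (hlip z n) ?_⟩
  · have h1 := hlt z
    rw [hn'] at h1
    have h2 : l * dist ((S ^ n) z) z₀ < l * r := by linarith [abs_nonneg (n : ℝ)]
    exact lt_of_mul_lt_mul_left h2 hl0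
  · have h1 : D ((S ^ n) z) ≤ |((0 : ℤ) : ℝ)| + l * dist ((S ^ (0 : ℤ)) ((S ^ n) z)) z₀ :=
      hle ((S ^ n) z) 0
    rw [Int.cast_zero, abs_zero, zero_add] at h1
    rw [hn']
    exact add_le_add le_rfl h1

theorem card_le_of_forall_lt_add {s : Finset ℕ} {Q : ℕ}
    (h : ∀ k ∈ s, ∀ k' ∈ s, k < k' → k' < k + Q) (hQ : 0 < Q) : s.card ≤ Q := by
  rcases s.eq_empty_or_nonempty with rfl | hs
  · simp
  · have hsub : s ⊆ Finset.Ico (s.min' hs) (s.min' hs + Q) := by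
      intro k hk
      have h1 := s.min'_le k hk
      rcases h1.lt_or_eq with h2 | h2
      · exact Finset.mem_Ico.2 ⟨h1, h _ (s.min'_mem hs) k hk h2⟩
      · exact Finset.mem_Ico.2 ⟨h1, by omega⟩
    simpa using Finset.card_le_card hsub

/-- Along an orbit segment containing at most one visit to the ball, the visit cost is piecewise of
slope `1` or `-1` with at most four pieces, so it meets an interval of length `Q` at most `4 * Q`
times. -/
theorem card_visit_cost_mem_Ico_le {Z : Type*} [MetricSpace Z] {S : Z ≃ₜ Z} {D : Z → ℝ} {z₀ : Z}
    {r : ℝ} {R Q : ℕ} (hQ : 0 < Q)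
    (hr : ∀ z, dist z z₀ < r → ∀ n : ℤ, 0 < n → n ≤ R → r ≤ dist ((S ^ n) z) z₀)
    (hlip : ∀ (z : Z) (n : ℤ), D z ≤ |(n : ℝ)| + D ((S ^ n) z))
    (hvisit : ∀ z, ∃ n : ℤ, dist ((S ^ n) z) z₀ < r ∧ D z = |(n : ℝ)| + D ((S ^ n) z))
    (t : ℝ) (z : Z) :
    ((Finset.range R).filter fun k => t ≤ D ((S ^ k) z) ∧ D ((S ^ k) z) < t + Q).card ≤ 4 * Q := by
  classical
  let d : ℤ → ℝ := fun k => D ((S ^ k) z)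
  have hd : ∀ k : ℕ, D ((S ^ k) z) = d k := fun k => by simp [d]
  have hlip' : ∀ k m : ℤ, d k ≤ |((m - k : ℤ) : ℝ)| + d m := by
    intro k m
    refine (hlip ((S ^ k) z) (m - k)).trans_eq ?_
    have : (S ^ (m - k)) ((S ^ k) z) = (S ^ m) z := by
      rw [← Homeomorph.mul_apply, ← zpow_add, sub_add_cancel]
    rw [this]
  have hvis : ∀ k : ℤ, ∃ m : ℤ, dist ((S ^ m) z) z₀ < r ∧ d k = |((m - k : ℤ) : ℝ)| + d m := by
    intro k
    obtain ⟨n, h1, h2⟩ := hvisit ((S ^ k) z)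
    rw [← Homeomorph.mul_apply, ← zpow_add] at h1 h2
    exact ⟨n + k, h1, by simpa [d] using h2⟩
  choose m hm1 hm2 using hvis
  -- two distinct visits are more than `R` apart
  have hsep : ∀ a b : ℤ, dist ((S ^ a) z) z₀ < r → dist ((S ^ b) z) z₀ < r → a < b → a + R < b := by
    intro a b ha hb hab
    by_contra hcon
    have h1 := hr _ ha (b - a) (by omega) (by omega)
    rw [← Homeomorph.mul_apply, ← zpow_add, sub_add_cancel] at h1
    linarith
  set s := (Finset.range R).filter fun k => t ≤ D ((S ^ k) z) ∧ D ((S ^ k) z) < t + Q with hs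
  have hmem : ∀ k ∈ s, k < R ∧ t ≤ d k ∧ d k < t + Q := fun k hk => by
    simpa [hs, hd] using hk
  have hleft : ∀ k ∈ s, ∀ k' ∈ s, k < k' → m k' ≤ k → k' < k + Q := by
    intro k hk k' hk' hkk h
    have h1 := hm2 k'
    have h2 := hlip' k (m k')
    rw [abs_of_nonpos (by exact_mod_cast (by omega : m k' - k' ≤ 0))] at h1
    rw [abs_of_nonpos (by exact_mod_cast (by omega : m k' - k ≤ 0))] at h2
    push_cast at h1 h2
    have h3 : (k' : ℝ) < k + Q := by linarith [(hmem k hk).2.1, (hmem k' hk').2.2]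
    exact_mod_cast h3
  have hright : ∀ k ∈ s, ∀ k' ∈ s, k < k' → k' ≤ m k → k' < k + Q := by
    intro k hk k' hk' hkk h
    have h1 := hm2 k
    have h2 := hlip' k' (m k)
    rw [abs_of_nonneg (by exact_mod_cast (by omega : 0 ≤ m k - k))] at h1
    rw [abs_of_nonneg (by exact_mod_cast (by omega : 0 ≤ m k - k'))] at h2
    push_cast at h1 h2
    have h3 : (k' : ℝ) < k + Q := by linarith [(hmem k' hk').2.1, (hmem k hk).2.2]
    exact_mod_cast h3
  have huniq : ∀ k k' : ℕ, 0 ≤ m k → m k < R → 0 ≤ m k' → m k' < R → m k = m k' := by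
    intro k k' h1 h2 h3 h4
    rcases lt_trichotomy (m k) (m k') with h | h | h
    · have := hsep _ _ (hm1 k) (hm1 k') h
      omega
    · exact h
    · have := hsep _ _ (hm1 k') (hm1 k) h
      omega
  have hcov : s ⊆ ((s.filter fun k : ℕ => m k < 0) ∪ (s.filter fun k : ℕ => 0 ≤ m k ∧ m k ≤ k)) ∪
      ((s.filter fun k : ℕ => (k : ℤ) < m k ∧ m k < R) ∪ (s.filter fun k : ℕ => (R : ℤ) ≤ m k)) := by
    intro k hk
    have := (hmem k hk).1
    simp only [Finset.mem_union, Finset.mem_filter, hk, true_and]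
    omega
  have c1 : (s.filter fun k : ℕ => m k < 0).card ≤ Q := by
    refine card_le_of_forall_lt_add (fun k hk k' hk' h => ?_) hQ
    rw [Finset.mem_filter] at hk hk'
    exact hleft k hk.1 k' hk'.1 h (by omega)
  have c2 : (s.filter fun k : ℕ => 0 ≤ m k ∧ m k ≤ k).card ≤ Q := by
    refine card_le_of_forall_lt_add (fun k hk k' hk' h => ?_) hQ
    rw [Finset.mem_filter] at hk hk'
    have a1 := (hmem k hk.1).1
    have a2 := (hmem k' hk'.1).1
    have a3 := huniq k k' (by omega) (by omega) (by omega) (by omega)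
    exact hleft k hk.1 k' hk'.1 h (by omega)
  have c3 : (s.filter fun k : ℕ => (k : ℤ) < m k ∧ m k < R).card ≤ Q := by
    refine card_le_of_forall_lt_add (fun k hk k' hk' h => ?_) hQ
    rw [Finset.mem_filter] at hk hk'
    have a3 := huniq k k' (by omega) (by omega) (by omega) (by omega)
    exact hright k hk.1 k' hk'.1 h (by omega)
  have c4 : (s.filter fun k : ℕ => (R : ℤ) ≤ m k).card ≤ Q := by
    refine card_le_of_forall_lt_add (fun k hk k' hk' h => ?_) hQ
    rw [Finset.mem_filter] at hk hk'
    have a2 := (hmem k' hk'.1).1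
    exact hright k hk.1 k' hk'.1 h (by omega)
  have := Finset.card_le_card hcov
  have e1 := Finset.card_union_le ((s.filter fun k : ℕ => m k < 0) ∪
    (s.filter fun k : ℕ => 0 ≤ m k ∧ m k ≤ k)) ((s.filter fun k : ℕ => (k : ℤ) < m k ∧ m k < R) ∪
    (s.filter fun k : ℕ => (R : ℤ) ≤ m k))
  have e2 := Finset.card_union_le (s.filter fun k : ℕ => m k < 0)
    (s.filter fun k : ℕ => 0 ≤ m k ∧ m k ≤ k)
  have e3 := Finset.card_union_le (s.filter fun k : ℕ => (k : ℤ) < m k ∧ m k < R)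
    (s.filter fun k : ℕ => (R : ℤ) ≤ m k)
  omega

variable [MeasurableSpace Z] [BorelSpace Z]

/-- There are continuous functions that vary by at most `1` along the dynamics and whose law gives
little mass to every interval of a prescribed length. -/
theorem IsMinimalSystem.exists_slow_spread [Infinite Z] (hS : IsMinimalSystem S)
    {ν : ProbabilityMeasure Z} (hν : MeasurePreserving S (ν : Measure Z) ν) {Q : ℕ} (hQ : 0 < Q)
    {η : ℝ} (hη : 0 < η) :
    ∃ D : C(Z, ℝ), (∀ z, 0 ≤ D z) ∧ (∀ z, |D (S z) - D z| ≤ 1) ∧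
      ∀ t : ℝ, (ν : Measure Z).real {z | t ≤ D z ∧ D z < t + Q} ≤ η := by
  obtain ⟨R, hR⟩ := exists_nat_gt (4 * Q / η)
  have hR0 : (0 : ℝ) < R := lt_of_le_of_lt (by positivity) hR
  obtain ⟨z₀⟩ : Nonempty Z := inferInstance
  obtain ⟨r, hr0, hr⟩ := hS.exists_radius_return z₀ R
  obtain ⟨D, hD0, hlip, hvisit⟩ := hS.exists_visit_cost z₀ hr0
  refine ⟨D, hD0, fun z => abs_sub_le_iff.2 ⟨?_, ?_⟩, fun t => ?_⟩
  · have h := hlip (S z) (-1)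
    rw [show (S ^ (-1 : ℤ)) (S z) = z by rw [zpow_neg_one]; exact S.symm_apply_apply z] at h
    norm_num at h
    linarith
  · have h := hlip z 1
    rw [zpow_one] at h
    norm_num at h
    linarith
  · set A : Set Z := {z | t ≤ D z ∧ D z < t + Q} with hA
    have hAm : MeasurableSet A :=
      (measurableSet_le measurable_const D.continuous.measurable).inter
        (measurableSet_lt D.continuous.measurable measurable_const)
    have hmeas : ∀ k : ℕ, MeasurableSet ((S ^ k) ⁻¹' A) := fun k =>
      (S ^ k).continuous.measurable hAm
    have h1 : ∀ k : ℕ, ∫ z, ((S ^ k) ⁻¹' A).indicator (fun _ => (1 : ℝ)) z ∂(ν : Measure Z) =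
        (ν : Measure Z).real A := by
      intro k
      rw [integral_indicator_const _ (hmeas k), smul_eq_mul, mul_one]
      exact (measurePreserving_homeo_pow hν k).measureReal_preimage hAm.nullMeasurableSet
    have h2 : (R : ℝ) * (ν : Measure Z).real A ≤ 4 * Q := by
      calc (R : ℝ) * (ν : Measure Z).real A
          = ∑ k ∈ Finset.range R,
            ∫ z, ((S ^ k) ⁻¹' A).indicator (fun _ => (1 : ℝ)) z ∂(ν : Measure Z) := by
            simp [h1]
        _ = ∫ z, ∑ k ∈ Finset.range R,
              ((S ^ k) ⁻¹' A).indicator (fun _ => (1 : ℝ)) z ∂(ν : Measure Z) :=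
            (integral_finsetSum _ fun k _ => (integrable_const _).indicator (hmeas k)).symm
        _ ≤ ∫ z, (4 * Q : ℝ) ∂(ν : Measure Z) := by
            refine integral_mono (integrable_finsetSum _ fun k _ =>
              (integrable_const _).indicator (hmeas k)) (integrable_const _) fun z => ?_
            have h3 := card_visit_cost_mem_Ico_le hQ hr hlip hvisit t z
            have h4 : ∀ k : ℕ, ((S ^ k) ⁻¹' A).indicator (fun _ => (1 : ℝ)) z =
                if t ≤ D ((S ^ k) z) ∧ D ((S ^ k) z) < t + Q then 1 else 0 := fun k => by
              by_cases hk : t ≤ D ((S ^ k) z) ∧ D ((S ^ k) z) < t + Q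
              · rw [if_pos hk]
                exact Set.indicator_of_mem (show z ∈ (S ^ k) ⁻¹' A from hk) _
              · rw [if_neg hk]
                exact Set.indicator_of_notMem (show z ∉ (S ^ k) ⁻¹' A from hk) _
            simp only [h4]
            rw [Finset.sum_boole]
            exact_mod_cast h3
        _ = 4 * Q := by simp
    rw [div_lt_iff₀ hη] at hR
    by_contra! hcon
    nlinarith

end Minimal

/-! ### Plateaus and slow transfer functions -/

section Plateaus

/-- A bounded function whose law gives little mass to every interval of length `Q` has approximate
`M`-quantiles that are separated by gaps of length `Q`. -/
theorem exists_spread_quantiles {Z : Type*} [MeasurableSpace Z] (ν : Measure Z)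
    [IsProbabilityMeasure ν] {D : Z → ℝ} (hD : Measurable D) {b : ℝ} (h0 : ∀ z, 0 ≤ D z)
    (hb : ∀ z, D z ≤ b) {Q : ℕ} (hQ : 0 < Q) {η : ℝ}
    (hη : ∀ t : ℝ, ν.real {z | t ≤ D z ∧ D z < t + Q} ≤ η) {M : ℕ} (hM : 0 < M) :
    ∃ t : ℕ → ℝ, Monotone t ∧
      ∀ j < M, 1 / (M : ℝ) - 2 * η ≤ ν.real {z | t j + Q ≤ D z ∧ D z < t (j + 1)} := by
  classical
  have hM' : (0 : ℝ) < M := by exact_mod_cast hM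
  have hQ' : (0 : ℝ) < Q := by exact_mod_cast hQ
  have hη0 : 0 ≤ η := measureReal_nonneg.trans (hη 0)
  let F : ℝ → ℝ := fun x => ν.real {z | D z < x}
  have hFm : ∀ x, MeasurableSet {z | D z < x} := fun x => measurableSet_lt hD measurable_const
  have hF1 : ∀ x, F x ≤ 1 := fun x => measureReal_le_one
  have hF0 : F 0 = 0 := by
    have : {z | D z < 0} = ∅ := Set.eq_empty_of_forall_notMem fun z hz =>
      absurd (show D z < 0 from hz) (not_lt.2 (h0 z))
    simp [F, this]
  have hFdiff : ∀ x y, F y - F x ≤ ν.real {z | x ≤ D z ∧ D z < y} := by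
    intro x y
    have hsub : {z | D z < y} ⊆ {z | D z < x} ∪ {z | x ≤ D z ∧ D z < y} := by
      intro z hz
      rcases lt_or_ge (D z) x with h | h
      · exact Or.inl h
      · exact Or.inr ⟨h, hz⟩
    have h1 : F y ≤ ν.real ({z | D z < x} ∪ {z | x ≤ D z ∧ D z < y}) := measureReal_mono hsub
    have h2 := measureReal_union_le (μ := ν) {z | D z < x} {z | x ≤ D z ∧ D z < y}
    change _ ≤ F x + _ at h2
    linarith
  obtain ⟨B, hB⟩ := exists_nat_gt (b / Q)
  have hFB : F (B * Q) = 1 := by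
    have : {z | D z < B * Q} = Set.univ := Set.eq_univ_of_forall fun z => by
      rw [div_lt_iff₀ hQ'] at hB
      exact (hb z).trans_lt hB
    simp [F, this]
  let k : ℕ → ℕ := fun j => Nat.findGreatest (fun k => F (k * Q) ≤ j / M) B
  have hk : ∀ j, F (k j * Q) ≤ j / M := fun j =>
    Nat.findGreatest_spec (P := fun k => F (k * Q) ≤ j / M) (Nat.zero_le B) (by
      simp only [Nat.cast_zero, zero_mul, hF0]
      positivity)
  have hk' : ∀ j ≤ M, (j : ℝ) / M - η ≤ F (k j * Q) := by
    intro j hj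
    have hj1 : (j : ℝ) / M ≤ 1 := by
      rw [div_le_one hM']
      exact_mod_cast hj
    rcases (Nat.findGreatest_le (P := fun k => F (k * Q) ≤ j / M) B).lt_or_eq with h | h
    · have h1 := Nat.findGreatest_is_greatest (P := fun k => F (k * Q) ≤ j / M)
        (Nat.lt_succ_self _) h
      change ¬ F (((k j + 1 : ℕ) : ℝ) * Q) ≤ j / M at h1
      have h2 := (hFdiff (k j * Q) (k j * Q + Q)).trans (hη _)
      have h3 : (((k j + 1 : ℕ) : ℝ) * Q) = k j * Q + Q := by push_cast; ring
      rw [h3] at h1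
      linarith
    · have h1 : k j = B := h
      rw [h1, hFB]
      linarith
  have hmono : Monotone fun j => (k j : ℝ) * Q := by
    intro i j hij
    have h1 : k i ≤ k j := Nat.findGreatest_mono_left (fun n hn => le_trans hn (by gcongr)) B
    have h2 : (k i : ℝ) ≤ k j := by exact_mod_cast h1
    exact mul_le_mul_of_nonneg_right h2 hQ'.le
  refine ⟨fun j => k j * Q, hmono, fun j hj => ?_⟩
  have h1 := hk' (j + 1) hj
  have h2 := hk j
  have h3 := (hFdiff (k j * Q) (k j * Q + Q)).trans (hη _)
  have h4 := hFdiff (k j * Q + Q) (k (j + 1) * Q)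
  have h5 : ((j + 1 : ℕ) : ℝ) / M = j / M + 1 / M := by push_cast; ring
  rw [h5] at h1
  linarith

/-- In an infinite minimal system there are continuous functions that vary slowly along the
dynamics and spend about the same proportion `1 / M` of the space at each of `M` given values. -/
theorem IsMinimalSystem.exists_slow_plateaus {Z : Type*} [MetricSpace Z] [CompactSpace Z]
    [MeasurableSpace Z] [BorelSpace Z] [Infinite Z] {S : Z ≃ₜ Z} (hS : IsMinimalSystem S)
    {ν : ProbabilityMeasure Z} (hν : MeasurePreserving S (ν : Measure Z) ν) {M : ℕ} (hM : 0 < M)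
    (τ : ℕ → ℝ) (hτ : ∀ j, τ j ∈ Set.Icc (0 : ℝ) 1) {ε η : ℝ} (hε : 0 < ε) (hη : 0 < η) :
    ∃ (g : C(Z, ℝ)) (E : ℕ → Set Z), (∀ z, |g (S z) - g z| ≤ ε) ∧ (∀ j, MeasurableSet (E j)) ∧
      Pairwise (Function.onFun Disjoint E) ∧
      ∀ j < M, (∀ z ∈ E j, g z = τ j) ∧ 1 / (M : ℝ) - η ≤ (ν : Measure Z).real (E j) := by
  have hM' : (0 : ℝ) < M := by exact_mod_cast hM
  obtain ⟨Q, hQ⟩ := exists_nat_gt (M / ε)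
  have hQ' : (0 : ℝ) < Q := lt_trans (by positivity) hQ
  have hQ0 : 0 < Q := by exact_mod_cast hQ'
  obtain ⟨D, hD0, hD1, hD⟩ := hS.exists_slow_spread hν hQ0 (half_pos hη)
  obtain ⟨b, hb⟩ := (isCompact_range D.continuous).bddAbove
  obtain ⟨t, ht, htj⟩ := exists_spread_quantiles (ν : Measure Z) D.continuous.measurable hD0
    (fun z => hb ⟨z, rfl⟩) hQ0 hD hM
  let w : ℕ → Z → ℝ := fun i z => max 0 (min 1 ((D z - t (i + 1)) / Q))
  let g : C(Z, ℝ) := ⟨fun z => τ 0 + ∑ i ∈ Finset.range M, (τ (i + 1) - τ i) * w i z, by fun_prop⟩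
  refine ⟨g, fun j => {z | t j + Q ≤ D z ∧ D z < t (j + 1)}, fun z => ?_, fun j => ?_, ?_,
    fun j hj => ⟨fun z hz => ?_, by linarith [htj j hj]⟩⟩
  · have hw : ∀ i, |w i (S z) - w i z| ≤ 1 / Q := by
      intro i
      refine (abs_max_sub_max_le_max _ _ _ _).trans (max_le ?_
        ((abs_min_sub_min_le_max _ _ _ _).trans (max_le ?_ ?_)))
      · rw [sub_self, abs_zero]
        positivity
      · rw [sub_self, abs_zero]
        positivity
      rw [← sub_div, abs_div, abs_of_pos hQ', sub_sub_sub_cancel_right]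
      gcongr
      exact hD1 z
    have hτ' : ∀ i, |τ (i + 1) - τ i| ≤ 1 := fun i => by
      rw [abs_sub_le_iff]
      constructor <;> linarith [(hτ i).1, (hτ i).2, (hτ (i + 1)).1, (hτ (i + 1)).2]
    have h1 : g (S z) - g z =
        ∑ i ∈ Finset.range M, (τ (i + 1) - τ i) * (w i (S z) - w i z) := by
      change (τ 0 + ∑ i ∈ Finset.range M, (τ (i + 1) - τ i) * w i (S z)) -
        (τ 0 + ∑ i ∈ Finset.range M, (τ (i + 1) - τ i) * w i z) = _
      simp only [mul_sub, Finset.sum_sub_distrib]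
      ring
    rw [h1]
    refine (Finset.abs_sum_le_sum_abs _ _).trans ?_
    refine (Finset.sum_le_sum (g := fun _ => 1 / (Q : ℝ)) fun i _ => ?_).trans ?_
    · rw [abs_mul]
      calc _ ≤ 1 * (1 / (Q : ℝ)) := mul_le_mul (hτ' i) (hw i) (abs_nonneg _) zero_le_one
        _ = _ := one_mul _
    · rw [Finset.sum_const, Finset.card_range, nsmul_eq_mul, mul_one_div, div_le_iff₀ hQ']
      rw [div_lt_iff₀ hε] at hQ
      linarith
  · exact (measurableSet_le measurable_const D.continuous.measurable).inter
      (measurableSet_lt D.continuous.measurable measurable_const)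
  · refine (pairwise_disjoint_on _).2 fun i j hij => Set.disjoint_left.2 fun z hi hj => ?_
    have h1 := ht (show i + 1 ≤ j from hij)
    linarith [hi.2, hj.1]
  · change τ 0 + ∑ i ∈ Finset.range M, (τ (i + 1) - τ i) * w i z = τ j
    obtain ⟨hz1, hz2⟩ : t j + Q ≤ D z ∧ D z < t (j + 1) := hz
    have hw1 : ∀ i ∈ Finset.range M, i ∉ Finset.range j → (τ (i + 1) - τ i) * w i z = 0 := by
      intro i _ hi
      have h1 := ht (show j + 1 ≤ i + 1 by simpa using hi)
      have h2 : (D z - t (i + 1)) / Q ≤ 0 := div_nonpos_of_nonpos_of_nonneg (by linarith) hQ'.le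
      have h3 : w i z = 0 := max_eq_left ((min_le_right _ _).trans h2)
      rw [h3, mul_zero]
    have hw2 : ∀ i ∈ Finset.range j, (τ (i + 1) - τ i) * w i z = τ (i + 1) - τ i := by
      intro i hi
      have h1 := ht (show i + 1 ≤ j from Finset.mem_range.1 hi)
      have h2 : 1 ≤ (D z - t (i + 1)) / Q := by
        rw [one_le_div hQ']
        linarith
      have h3 : w i z = 1 := by
        change max 0 (min 1 ((D z - t (i + 1)) / Q)) = 1
        rw [min_eq_left h2, max_eq_right zero_le_one]
      rw [h3, mul_one]
    rw [← Finset.sum_subset (Finset.range_mono hj.le) hw1, Finset.sum_congr rfl hw2,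
      Finset.sum_range_sub]
    ring

/-- The slow transfer map: under condition (A) there is a continuous `K : Z → 𝒢` which is nearly
invariant under `S` and such that, for every `y`, the point `K z⁻¹ y` lies in the prescribed open
set `V` for all `z` outside a set of small measure. It follows a path through the homeomorphisms
of condition (A), along a slow function that stays about equally long at each of them. -/
theorem IsMinimalSystem.exists_slow_transfer {Z Y : Type*} [MetricSpace Z] [CompactSpace Z]
    [MeasurableSpace Z] [BorelSpace Z] [Infinite Z] [MetricSpace Y] [CompactSpace Y] {S : Z ≃ₜ Z}
    (hS : IsMinimalSystem S) {ν : ProbabilityMeasure Z}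
    (hν : MeasurePreserving S (ν : Measure Z) ν) {𝒢 : Subgroup (Y ≃ₜ Y)}
    (hp : IsPathConnected (𝒢 : Set (Y ≃ₜ Y))) (hA : ConditionA 𝒢) {V : Set Y} (hV : IsOpen V)
    (hne : V.Nonempty) {ε η : ℝ} (hε : 0 < ε) (hη : 0 < η) :
    ∃ K : C(Z, 𝒢), (∀ z, dist ((K (S z) : Y ≃ₜ Y)⁻¹ * K z) 1 < ε) ∧
      ∀ y, (ν : Measure Z).real {z | (K z : Y ≃ₜ Y)⁻¹ y ∉ V} ≤ η := by
  classical
  obtain ⟨M, hM, h, hmem, hh⟩ := hA V hV hne (η / 2) (half_pos hη)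
  have hM' : (0 : ℝ) < M := by exact_mod_cast hM
  obtain ⟨m, rfl⟩ : ∃ m, M = m + 1 := ⟨M - 1, by omega⟩
  obtain ⟨γ, τ, hγ, hτ⟩ := hp.exists_path_through_family' h hmem
  let p : ℝ → 𝒢 := fun s => ⟨γ (Set.projIcc 0 1 zero_le_one s), hγ _⟩
  have hpc : Continuous p :=
    Continuous.subtype_mk (γ.continuous.comp continuous_projIcc) _
  -- the path is uniformly continuous in the sense needed for the defect `K (S z)⁻¹ * K z`
  obtain ⟨θ, hθ, hpθ⟩ : ∃ θ > 0, ∀ s s' : ℝ, |s - s'| ≤ θ →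
      dist ((p s : Y ≃ₜ Y)⁻¹ * p s') 1 < ε := by
    let q : unitInterval × unitInterval → (Y ≃ₜ Y) := fun a => (γ a.1)⁻¹ * γ a.2
    have hq : Continuous q := by fun_prop
    have hqu := CompactSpace.uniformContinuous_of_continuous hq
    obtain ⟨θ, hθ, hd⟩ := Metric.uniformContinuous_iff.1 hqu ε hε
    refine ⟨θ / 2, half_pos hθ, fun s s' hs => ?_⟩
    have h1 := @hd (Set.projIcc 0 1 zero_le_one s, Set.projIcc 0 1 zero_le_one s')
      (Set.projIcc 0 1 zero_le_one s, Set.projIcc 0 1 zero_le_one s) ?_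
    · have h2 : q (Set.projIcc 0 1 zero_le_one s, Set.projIcc 0 1 zero_le_one s) = 1 :=
        inv_mul_cancel _
      rwa [h2] at h1
    · rw [Prod.dist_eq, dist_self, max_eq_right dist_nonneg]
      refine lt_of_le_of_lt ?_ (half_lt_self hθ)
      have h3 := (LipschitzWith.projIcc (zero_le_one' ℝ)).dist_le_mul s' s
      rw [NNReal.coe_one, one_mul, Real.dist_eq, abs_sub_comm] at h3
      exact h3.trans hs
  let τ' : ℕ → ℝ := fun j => if hj : j < m + 1 then (τ ⟨j, hj⟩ : ℝ) else 0
  have hτ' : ∀ j, τ' j ∈ Set.Icc (0 : ℝ) 1 := by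
    intro j
    by_cases hj : j < m + 1
    · simp only [τ', hj, dite_true]
      exact (τ ⟨j, hj⟩).2
    · simp only [τ', hj, dite_false]
      exact ⟨le_rfl, zero_le_one⟩
  have hpτ : ∀ j : Fin (m + 1), (p (τ' j) : Y ≃ₜ Y) = h j := by
    intro j
    simp only [p, τ', j.2, dite_true]
    rw [Set.projIcc_val]
    exact hτ j
  obtain ⟨g, E, hg1, hEm, hEd, hg2⟩ := hS.exists_slow_plateaus hν hM τ' hτ' hθ
    (η := η / (2 * (m + 1 : ℕ))) (by positivity)
  refine ⟨⟨fun z => p (g z), hpc.comp g.continuous⟩, fun z => hpθ _ _ (hg1 z), fun y => ?_⟩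
  -- the good indices for `y` are at least `(1 - η / 2) * M` many, and each of them is taken on a
  -- set of measure about `1 / M`
  let J : Finset (Fin (m + 1)) := Finset.univ.filter fun j => y ∉ h j '' Vᶜ
  have hJ : (1 - η / 2) * (m + 1 : ℕ) ≤ J.card := by
    have h1 := hh y
    have h2 : ∑ j, Set.indicator (h j '' Vᶜ) (fun _ => (1 : ℝ)) y = (m + 1 : ℕ) - J.card := by
      have h3 : ∀ j, Set.indicator (h j '' Vᶜ) (fun _ => (1 : ℝ)) y =
          1 - if y ∉ h j '' Vᶜ then 1 else 0 := by
        intro j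
        by_cases hj : y ∈ h j '' Vᶜ <;> simp only [Set.indicator_apply, hj] <;> norm_num
      simp only [h3, Finset.sum_sub_distrib, Finset.sum_boole, J]
      simp
    rw [h2, one_div, inv_mul_le_iff₀ hM'] at h1
    linarith
  have hgoodset : ∀ j ∈ J, E j ⊆ {z | (p (g z) : Y ≃ₜ Y)⁻¹ y ∈ V} := by
    intro j hj z hz
    change (p (g z) : Y ≃ₜ Y)⁻¹ y ∈ V
    rw [(hg2 j j.2).1 z hz, hpτ]
    by_contra hcon
    exact (Finset.mem_filter.1 hj).2 ⟨_, hcon, (h j).apply_symm_apply y⟩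
  have hUm : MeasurableSet (⋃ j ∈ J, E j) := Finset.measurableSet_biUnion _ fun j _ => hEm j
  have hU : (J.card : ℝ) * ((1 - η / 2) / (m + 1 : ℕ)) ≤ (ν : Measure Z).real (⋃ j ∈ J, E j) := by
    rw [measureReal_biUnion_finset (f := fun j : Fin (m + 1) => E j)
      (fun i _ j _ hij => hEd fun h => hij (Fin.ext h)) (fun j _ => hEm j), ← nsmul_eq_mul]
    refine Finset.card_nsmul_le_sum _ _ _ fun j _ => ?_
    refine le_trans (le_of_eq ?_) (hg2 j j.2).2
    field_simp
  have hbad : (ν : Measure Z).real {z | (p (g z) : Y ≃ₜ Y)⁻¹ y ∉ V} ≤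
      1 - (ν : Measure Z).real (⋃ j ∈ J, E j) := by
    rw [← probReal_compl_eq_one_sub hUm]
    refine measureReal_mono fun z hz hzU => ?_
    obtain ⟨j, hj, hzj⟩ := Set.mem_iUnion₂.1 hzU
    exact hz (hgoodset j hj hzj)
  change (ν : Measure Z).real {z | (p (g z) : Y ≃ₜ Y)⁻¹ y ∉ V} ≤ η
  rcases le_total 2 η with h2 | h2
  · exact measureReal_le_one.trans (by linarith)
  · have h3 : (1 - η / 2) * (1 - η / 2) ≤ (J.card : ℝ) * ((1 - η / 2) / (m + 1 : ℕ)) := by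
      calc _ = (1 - η / 2) * (m + 1 : ℕ) * ((1 - η / 2) / (m + 1 : ℕ)) := by field_simp
        _ ≤ _ := mul_le_mul_of_nonneg_right hJ (by
          have : 0 ≤ 1 - η / 2 := by linarith
          positivity)
    nlinarith

end Plateaus

/-! ### Perturbing coboundaries -/

section Perturbation

variable {Z Y : Type*} [MetricSpace Z] [CompactSpace Z] [MetricSpace Y] [CompactSpace Y]
  {S : Z ≃ₜ Z} {𝒢 : Subgroup (Y ≃ₜ Y)}

theorem continuous_transfer_inv_apply (H : C(Z, 𝒢)) :
    Continuous fun q : Z × Y => (H q.1 : Y ≃ₜ Y)⁻¹ q.2 :=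
  continuous_cocycle_inv_apply.comp (Continuous.prodMk continuous_const continuous_id)

/-- The homeomorphisms `(H z)⁻¹` are uniformly equicontinuous. -/
theorem exists_forall_dist_transfer_inv_lt (H : C(Z, 𝒢)) {ε : ℝ} (hε : 0 < ε) :
    ∃ ρ > 0, ∀ (z : Z) (a b : Y), dist a b < ρ →
      dist ((H z : Y ≃ₜ Y)⁻¹ a) ((H z : Y ≃ₜ Y)⁻¹ b) < ε := by
  obtain ⟨ρ, hρ, h⟩ := Metric.uniformContinuous_iff.1
    (CompactSpace.uniformContinuous_of_continuous (continuous_transfer_inv_apply H)) ε hε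
  refine ⟨ρ, hρ, fun z a b hab => @h (z, a) (z, b) ?_⟩
  rw [Prod.dist_eq, dist_self, max_eq_right dist_nonneg]
  exact hab

/-- Multiplying a transfer function `H` on the left by a nearly invariant `K` changes its
coboundary only slightly. -/
theorem exists_forall_dist_coboundary_mul_lt (S : Z ≃ₜ Z) (H : C(Z, 𝒢)) {ε : ℝ} (hε : 0 < ε) :
    ∃ ρ > 0, ∀ K : C(Z, 𝒢), (∀ z, dist ((K (S z) : Y ≃ₜ Y)⁻¹ * K z) 1 < ρ) →
      ∀ z, dist (((K * H) (S z) : Y ≃ₜ Y)⁻¹ * (K * H) z) ((H (S z) : Y ≃ₜ Y)⁻¹ * H z) < ε := by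
  obtain ⟨ρ, hρ, h⟩ := exists_forall_dist_transfer_inv_lt H hε
  refine ⟨ρ, hρ, fun K hK z => (dist_homeo_lt_iff hε).2 fun y => ?_⟩
  have h1 := (dist_homeo_lt_iff hρ).1 (hK z) ((H z : Y ≃ₜ Y) y)
  have h2 := h (S z) _ _ h1
  simpa [mul_inv_rev, mul_assoc] using h2

variable [MeasurableSpace Z] [BorelSpace Z]

theorem measurableSet_transfer_inv_notMem (K : C(Z, 𝒢)) {V : Set Y} (hV : IsOpen V) (y : Y) :
    MeasurableSet {z | (K z : Y ≃ₜ Y)⁻¹ y ∉ V} :=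
  (hV.preimage ((continuous_transfer_inv_apply K).comp
    (Continuous.prodMk_left y))).measurableSet.compl

/-- Every coboundary is a limit of coboundaries whose skew products collapse fibers up to `δ`. -/
theorem exists_coboundary_collapsing [Infinite Z] [Nonempty Y] (hS : IsMinimalSystem S)
    {ν : ProbabilityMeasure Z} (hν : IsUniqueInvariantMeasure S ν)
    (hp : IsPathConnected (𝒢 : Set (Y ≃ₜ Y))) (hA : ConditionA 𝒢) (H : C(Z, 𝒢)) {ε δ : ℝ}
    (hε : 0 < ε) (hδ : 0 < δ) :
    ∃ H' : C(Z, 𝒢),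
      (∀ z, dist ((H' (S z) : Y ≃ₜ Y)⁻¹ * H' z) ((H (S z) : Y ≃ₜ Y)⁻¹ * H z) < ε) ∧
      ∃ N : ℕ, ∀ (z : Z) (y y' : Y), ∑ n ∈ Finset.range (N + 1),
        dist ((H' ((S ^ n) z) : Y ≃ₜ Y)⁻¹ y) ((H' ((S ^ n) z) : Y ≃ₜ Y)⁻¹ y') <
          δ * ((N + 1 : ℕ) : ℝ) := by
  obtain ⟨ρ, hρ, hclose⟩ := exists_forall_dist_coboundary_mul_lt S H hε
  obtain ⟨σ, hσ, hequi⟩ := exists_forall_dist_transfer_inv_lt H (half_pos hδ)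
  obtain ⟨y₀⟩ := ‹Nonempty Y›
  set C : ℝ := Metric.diam (Set.univ : Set Y) + 1 with hC
  have hC0 : 0 < C := by positivity
  have hdiam : ∀ a b : Y, dist a b ≤ C := fun a b =>
    (Metric.dist_le_diam_of_mem isCompact_univ.isBounded (Set.mem_univ a)
      (Set.mem_univ b)).trans (by linarith)
  obtain ⟨K, hK1, hK2⟩ := hS.exists_slow_transfer ((hν ν).2 rfl) hp hA
    (Metric.isOpen_ball (x := y₀) (ε := σ / 2)) ⟨y₀, Metric.mem_ball_self (half_pos hσ)⟩ hρ
    (η := δ / (8 * C)) (by positivity)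
  refine ⟨K * H, hclose K hK1, ?_⟩
  let F : C(Y × Y, C(Z, ℝ)) := ContinuousMap.curry
    ⟨fun q : (Y × Y) × Z => dist (((K * H) q.2 : Y ≃ₜ Y)⁻¹ q.1.1) (((K * H) q.2 : Y ≃ₜ Y)⁻¹ q.1.2),
      ((continuous_transfer_inv_apply (K * H)).comp
        (continuous_snd.prodMk (continuous_fst.comp continuous_fst))).dist
      ((continuous_transfer_inv_apply (K * H)).comp
        (continuous_snd.prodMk (continuous_snd.comp continuous_fst)))⟩
  have hF : ∀ p z, F p z = dist (((K * H) z : Y ≃ₜ Y)⁻¹ p.1) (((K * H) z : Y ≃ₜ Y)⁻¹ p.2) :=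
    fun p z => rfl
  suffices hmean : ∀ p, ∫ z, F p z ∂(ν : Measure Z) < δ by
    obtain ⟨N, hN⟩ := (hν.eventually_sum_lt_of_compact F hmean).exists
    exact ⟨N, fun z y y' => hN (y, y') z⟩
  intro p
  let B : Y → Set Z := fun y => {z | (K z : Y ≃ₜ Y)⁻¹ y ∉ Metric.ball y₀ (σ / 2)}
  have hBm : ∀ y, MeasurableSet (B y) := fun y =>
    measurableSet_transfer_inv_notMem K Metric.isOpen_ball y
  have hbound : ∀ z, F p z ≤
      δ / 2 + ((B p.1).indicator (fun _ => C) z + (B p.2).indicator (fun _ => C) z) := by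
    intro z
    have hn : ∀ y, 0 ≤ (B y).indicator (fun _ => C) z := fun y =>
      Set.indicator_nonneg (fun _ _ => hC0.le) z
    by_cases h1 : z ∈ B p.1
    · have h3 : (B p.1).indicator (fun _ => C) z = C := Set.indicator_of_mem h1 _
      rw [hF, h3]
      linarith [hn p.2, hdiam (((K * H) z : Y ≃ₜ Y)⁻¹ p.1) (((K * H) z : Y ≃ₜ Y)⁻¹ p.2)]
    by_cases h2 : z ∈ B p.2
    · have h3 : (B p.2).indicator (fun _ => C) z = C := Set.indicator_of_mem h2 _
      rw [hF, h3]
      linarith [hn p.1, hdiam (((K * H) z : Y ≃ₜ Y)⁻¹ p.1) (((K * H) z : Y ≃ₜ Y)⁻¹ p.2)]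
    · have h3 : dist ((K z : Y ≃ₜ Y)⁻¹ p.1) ((K z : Y ≃ₜ Y)⁻¹ p.2) < σ := by
        have h4 := Metric.mem_ball.1 (not_not.1 h1)
        have h5 := Metric.mem_ball.1 (not_not.1 h2)
        linarith [dist_triangle_right ((K z : Y ≃ₜ Y)⁻¹ p.1) ((K z : Y ≃ₜ Y)⁻¹ p.2) y₀]
      have h4 := hequi z _ _ h3
      have h5 : F p z < δ / 2 := by
        rw [hF]
        simpa [mul_inv_rev] using h4
      linarith [hn p.1, hn p.2]
  have hind : ∀ y, Integrable ((B y).indicator fun _ => C) (ν : Measure Z) := fun y =>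
    (integrable_const C).indicator (hBm y)
  have hsum : Integrable (fun z => (B p.1).indicator (fun _ => C) z +
      (B p.2).indicator (fun _ => C) z) (ν : Measure Z) := (hind _).add (hind _)
  have hI : ∀ y, ∫ z, (B y).indicator (fun _ => C) z ∂(ν : Measure Z) ≤ δ / 8 := by
    intro y
    rw [integral_indicator_const _ (hBm y), smul_eq_mul]
    calc (ν : Measure Z).real (B y) * C ≤ δ / (8 * C) * C :=
          mul_le_mul_of_nonneg_right (hK2 y) hC0.le
      _ = δ / 8 := by field_simp
  calc ∫ z, F p z ∂(ν : Measure Z)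
      ≤ ∫ z, (δ / 2 + ((B p.1).indicator (fun _ => C) z + (B p.2).indicator (fun _ => C) z))
          ∂(ν : Measure Z) := integral_mono (continuousMap_integrable _ _)
            ((integrable_const _).add hsum) hbound
    _ = δ / 2 + (∫ z, (B p.1).indicator (fun _ => C) z ∂(ν : Measure Z) +
          ∫ z, (B p.2).indicator (fun _ => C) z ∂(ν : Measure Z)) := by
        rw [integral_add (integrable_const _) hsum,
          integral_add (hind _) (hind _)]
        simp
    _ < δ := by linarith [hI p.1, hI p.2]

theorem measurePreserving_homeo_zpow {X : Type*} [TopologicalSpace X] [MeasurableSpace X]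
    [BorelSpace X] {T : X ≃ₜ X} {μ : Measure X} (h : MeasurePreserving T μ μ) (n : ℤ) :
    MeasurePreserving (T ^ n : X ≃ₜ X) μ μ := by
  cases n with
  | ofNat n => simpa using measurePreserving_homeo_pow h n
  | negSucc n =>
    rw [zpow_negSucc]
    exact MeasurePreserving.symm (T ^ (n + 1)).toMeasurableEquiv
      (measurePreserving_homeo_pow h (n + 1))

theorem IsMinimalSystem.measureReal_pos {Z : Type*} [TopologicalSpace Z] [MeasurableSpace Z]
    [BorelSpace Z] {S : Z ≃ₜ Z} (hS : IsMinimalSystem S) {ν : ProbabilityMeasure Z}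
    (hν : MeasurePreserving S (ν : Measure Z) ν) {O : Set Z} (hO : IsOpen O) (hne : O.Nonempty) :
    0 < (ν : Measure Z).real O := by
  refine measureReal_nonneg.lt_of_ne' fun h0 => ?_
  rw [measureReal_eq_zero_iff] at h0
  have h1 : (⋃ n : ℤ, (S ^ n) ⁻¹' O) = Set.univ := Set.eq_univ_of_forall fun z =>
    Set.mem_iUnion.2 (hS.exists_zpow_mem hO hne z)
  have h2 : (ν : Measure Z) (⋃ n : ℤ, (S ^ n) ⁻¹' O) = 0 := measure_iUnion_null fun n => by
    rw [(measurePreserving_homeo_zpow hν n).measure_preimage hO.measurableSet.nullMeasurableSet, h0]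
  rw [h1, measure_univ] at h2
  exact one_ne_zero h2

/-- Every coboundary is a limit of coboundaries for which all orbits of the skew product visit a
given open rectangle. -/
theorem exists_coboundary_visiting [Infinite Z] (hS : IsMinimalSystem S)
    {ν : ProbabilityMeasure Z} (hν : MeasurePreserving S (ν : Measure Z) ν)
    (hp : IsPathConnected (𝒢 : Set (Y ≃ₜ Y))) (hA : ConditionA 𝒢) (H : C(Z, 𝒢)) {ε : ℝ}
    (hε : 0 < ε) {W : Set (Z × Y)} (hW : IsOpen W) (hWne : W.Nonempty) :
    ∃ H' : C(Z, 𝒢),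
      (∀ z, dist ((H' (S z) : Y ≃ₜ Y)⁻¹ * H' z) ((H (S z) : Y ≃ₜ Y)⁻¹ * H z) < ε) ∧
      ∀ (z : Z) (y : Y), ∃ n : ℤ, ((S ^ n) z, (H' ((S ^ n) z) : Y ≃ₜ Y)⁻¹ y) ∈ W := by
  obtain ⟨ρ, hρ, hclose⟩ := exists_forall_dist_coboundary_mul_lt S H hε
  obtain ⟨⟨z₁, v⟩, hv⟩ := hWne
  have hO : IsOpen {q : Z × Y | (q.1, (H q.1 : Y ≃ₜ Y)⁻¹ q.2) ∈ W} :=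
    hW.preimage (continuous_fst.prodMk (continuous_transfer_inv_apply H))
  obtain ⟨U, V, hU, hV, hzU, hyV, hUV⟩ := isOpen_prod_iff.1 hO z₁ ((H z₁ : Y ≃ₜ Y) v) (by
    change (z₁, (H z₁ : Y ≃ₜ Y)⁻¹ ((H z₁ : Y ≃ₜ Y) v)) ∈ W
    rwa [show (H z₁ : Y ≃ₜ Y)⁻¹ ((H z₁ : Y ≃ₜ Y) v) = v from (H z₁ : Y ≃ₜ Y).symm_apply_apply v])
  have hpos := hS.measureReal_pos hν hU ⟨z₁, hzU⟩
  obtain ⟨K, hK1, hK2⟩ := hS.exists_slow_transfer hν hp hA hV ⟨_, hyV⟩ hρ (half_pos hpos)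
  refine ⟨K * H, hclose K hK1, fun z y => ?_⟩
  have hO' : IsOpen (U ∩ {z | (K z : Y ≃ₜ Y)⁻¹ y ∈ V}) := hU.inter
    (hV.preimage ((continuous_transfer_inv_apply K).comp (Continuous.prodMk_left y)))
  have hne : (U ∩ {z | (K z : Y ≃ₜ Y)⁻¹ y ∈ V}).Nonempty := by
    by_contra hcon
    have hsub : U ⊆ {z | (K z : Y ≃ₜ Y)⁻¹ y ∉ V} := fun z hz hzV => hcon ⟨z, hz, hzV⟩
    have := (measureReal_mono (μ := (ν : Measure Z)) hsub).trans (hK2 y)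
    linarith
  obtain ⟨n, hn1, hn2⟩ := hS.exists_zpow_mem hO' hne z
  refine ⟨n, ?_⟩
  have := hUV (Set.mk_mem_prod hn1 hn2)
  simpa [mul_inv_rev] using this

end Perturbation

/-! ### Generic cocycles -/

section Generic

variable {Z Y : Type*} [MetricSpace Z] [CompactSpace Z] [MetricSpace Y] [CompactSpace Y]

theorem isOpen_setOf_forall_of_compact {A P : Type*} [TopologicalSpace A] [TopologicalSpace P]
    [CompactSpace P] {O : Set (A × P)} (hO : IsOpen O) : IsOpen {a | ∀ p, (a, p) ∈ O} := by
  refine isOpen_iff_mem_nhds.2 fun a ha => ?_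
  have := isCompact_univ.eventually_forall_of_forall_eventually (x₀ := a) (X := A) (Y := P)
    (P := fun a p => (a, p) ∈ O) fun p _ => hO.mem_nhds (ha p)
  filter_upwards [this] with b hb p using hb p (Set.mem_univ p)

theorem dense_preimage_closure {E : Type*} [PseudoMetricSpace E] {A O : Set E}
    (h : ∀ a ∈ A, ∀ ε > 0, ∃ b ∈ A, dist b a < ε ∧ b ∈ O) :
    Dense ((↑) ⁻¹' O : Set (closure A)) := by
  refine Metric.dense_iff.2 fun x r hr => ?_
  obtain ⟨a, ha, hxa⟩ := Metric.mem_closure_iff.1 x.2 (r / 2) (half_pos hr)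
  obtain ⟨b, hb, hba, hbO⟩ := h a ha (r / 2) (half_pos hr)
  refine ⟨⟨b, subset_closure hb⟩, ?_, hbO⟩
  rw [Metric.mem_ball, dist_comm]
  change dist (x : E) b < r
  linarith [dist_triangle (x : E) a b, dist_comm a b]

variable (S : Z ≃ₜ Z) (𝒢 : Subgroup (Y ≃ₜ Y))

theorem isOpen_setOf_visiting {W : Set (Z × Y)} (hW : IsOpen W) :
    IsOpen {G : C(Z, 𝒢) | ∀ x, ∃ n : ℤ, (skewProduct S 𝒢 G ^ n) x ∈ W} := by
  have h : IsOpen {q : C(Z, 𝒢) × Z × Y | ∃ n : ℤ, (skewProduct S 𝒢 q.1 ^ n) q.2 ∈ W} := by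
    simp only [Set.ofPred_exists]
    exact isOpen_iUnion fun n => hW.preimage (continuous_skewProduct_zpow S 𝒢 n)
  exact isOpen_setOf_forall_of_compact h

theorem isOpen_setOf_collapsing (δ : ℝ) :
    IsOpen {G : C(Z, 𝒢) | ∃ N : ℕ, ∀ (z : Z) (y y' : Y), ∑ n ∈ Finset.range (N + 1),
      dist ((skewProduct S 𝒢 G ^ n) (z, y)).2 ((skewProduct S 𝒢 G ^ n) (z, y')).2 <
        δ * ((N + 1 : ℕ) : ℝ)} := by
  simp only [Set.ofPred_exists]
  refine isOpen_iUnion fun N => ?_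
  have hT : ∀ n : ℕ, Continuous fun q : C(Z, 𝒢) × Z × Y => (skewProduct S 𝒢 q.1 ^ n) q.2 :=
    fun n => continuous_skewProduct_zpow S 𝒢 n
  have h : IsOpen {q : C(Z, 𝒢) × Z × Y × Y | ∑ n ∈ Finset.range (N + 1),
      dist ((skewProduct S 𝒢 q.1 ^ n) (q.2.1, q.2.2.1)).2
        ((skewProduct S 𝒢 q.1 ^ n) (q.2.1, q.2.2.2)).2 < δ * ((N + 1 : ℕ) : ℝ)} := by
    refine isOpen_lt (continuous_finsetSum _ fun n _ => ?_) continuous_const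
    exact (continuous_snd.comp ((hT n).comp (by fun_prop :
      Continuous fun q : C(Z, 𝒢) × Z × Y × Y => (q.1, q.2.1, q.2.2.1)))).dist
      (continuous_snd.comp ((hT n).comp (by fun_prop :
      Continuous fun q : C(Z, 𝒢) × Z × Y × Y => (q.1, q.2.1, q.2.2.2))))
  convert isOpen_setOf_forall_of_compact h using 1
  ext G
  exact ⟨fun hG p => hG p.1 p.2.1 p.2.2, fun hG z y y' => hG (z, y, y')⟩

variable {S 𝒢} [MeasurableSpace Z] [BorelSpace Z]

/-- Generic cocycles in the closure of a set `A` of coboundaries have minimal skew products with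
collapsing fibers. The transfer functions take values in a group `𝒢₀` which is path connected and
satisfies condition (A); the cocycles may take values in a larger group `𝒢`. -/
theorem exists_generic_minimal_collapsing [Infinite Z] [Nonempty Y] (hS : IsStrictlyErgodic S)
    {𝒢₀ : Subgroup (Y ≃ₜ Y)} (hle : 𝒢₀ ≤ 𝒢) (hp : IsPathConnected (𝒢₀ : Set (Y ≃ₜ Y)))
    (hA : ConditionA 𝒢₀) {A : Set C(Z, 𝒢)}
    (hmem : ∀ G, G ∈ A ↔ ∃ H : C(Z, 𝒢₀), ∀ z, (G z : Y ≃ₜ Y) = (H (S z) : Y ≃ₜ Y)⁻¹ * H z) :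
    ∃ R : Set (closure A), IsGδ R ∧ R ∈ residual (closure A) ∧
      ∀ G ∈ R, IsMinimalSystem (skewProduct S 𝒢 (G : C(Z, 𝒢))) ∧
        FibersCollapse (skewProduct S 𝒢 (G : C(Z, 𝒢))) := by
  obtain ⟨hmin, ν, hν⟩ := hS
  -- a property realized by perturbed transfer functions is dense
  have hdense : ∀ O : Set C(Z, 𝒢), (∀ (H : C(Z, 𝒢₀)) (ε : ℝ), 0 < ε → ∃ H' : C(Z, 𝒢₀),
      (∀ z, dist ((H' (S z) : Y ≃ₜ Y)⁻¹ * H' z) ((H (S z) : Y ≃ₜ Y)⁻¹ * H z) < ε) ∧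
      ∀ G : C(Z, 𝒢), (∀ z, (G z : Y ≃ₜ Y) = (H' (S z) : Y ≃ₜ Y)⁻¹ * H' z) → G ∈ O) →
      Dense ((↑) ⁻¹' O : Set (closure A)) := by
    intro O hO
    refine dense_preimage_closure fun G hG ε hε => ?_
    obtain ⟨H, hH⟩ := (hmem G).1 hG
    obtain ⟨H', hclose, hO'⟩ := hO H ε hε
    let G' : C(Z, 𝒢) := ⟨fun z => ⟨(H' (S z) : Y ≃ₜ Y)⁻¹ * H' z,
      hle (𝒢₀.mul_mem (𝒢₀.inv_mem (H' (S z)).2) (H' z).2)⟩, by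
        refine Continuous.subtype_mk ?_ _
        exact ((continuous_subtype_val.comp (H'.continuous.comp S.continuous)).inv).mul
          (continuous_subtype_val.comp H'.continuous)⟩
    have hG' : ∀ z, (G' z : Y ≃ₜ Y) = (H' (S z) : Y ≃ₜ Y)⁻¹ * H' z := fun z => rfl
    refine ⟨G', (hmem G').2 ⟨H', hG'⟩, (ContinuousMap.dist_lt_iff hε).2 fun z => ?_, hO' G' hG'⟩
    change dist (G' z : Y ≃ₜ Y) (G z : Y ≃ₜ Y) < ε
    rw [hG', hH]
    exact hclose z
  let E : ℕ → Set C(Z, 𝒢) := fun k => {G | ∃ N : ℕ, ∀ (z : Z) (y y' : Y),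
    ∑ n ∈ Finset.range (N + 1), dist ((skewProduct S 𝒢 G ^ n) (z, y)).2
      ((skewProduct S 𝒢 G ^ n) (z, y')).2 < (1 / ((k : ℝ) + 1)) * ((N + 1 : ℕ) : ℝ)}
  let V : Set (Z × Y) → Set C(Z, 𝒢) := fun W =>
    {G | ∀ x, ∃ n : ℤ, (skewProduct S 𝒢 G ^ n) x ∈ W}
  have hEo : ∀ k, IsOpen ((↑) ⁻¹' E k : Set (closure A)) := fun k =>
    (isOpen_setOf_collapsing S 𝒢 _).preimage continuous_subtype_val
  have hEd : ∀ k, Dense ((↑) ⁻¹' E k : Set (closure A)) := fun k => by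
    refine hdense _ fun H ε hε => ?_
    obtain ⟨H', h1, N, hN⟩ := exists_coboundary_collapsing hmin hν hp hA H hε
      (δ := 1 / ((k : ℝ) + 1)) (by positivity)
    refine ⟨H', h1, fun G hG => ⟨N, fun z y y' => ?_⟩⟩
    have h2 : ∀ (n : ℕ) (y : Y), ((skewProduct S 𝒢 G ^ n) (z, y)).2 =
        (H' ((S ^ n) z) : Y ≃ₜ Y)⁻¹ ((H' z : Y ≃ₜ Y) y) := fun n y =>
      congrArg Prod.snd (skewProduct_zpow_apply_of_coboundary S 𝒢
        (H := fun z => (H' z : Y ≃ₜ Y)) hG n z y)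
    simp only [h2]
    exact hN z _ _
  have hVo : ∀ W, IsOpen W → IsOpen ((↑) ⁻¹' V W : Set (closure A)) := fun W hW =>
    (isOpen_setOf_visiting S 𝒢 hW).preimage continuous_subtype_val
  have hVd : ∀ W, IsOpen W → W.Nonempty → Dense ((↑) ⁻¹' V W : Set (closure A)) := by
    intro W hW hWne
    refine hdense _ fun H ε hε => ?_
    obtain ⟨H', h1, h2⟩ := exists_coboundary_visiting hmin ((hν ν).2 rfl) hp hA H hε hW hWne
    refine ⟨H', h1, fun G hG x => ?_⟩
    obtain ⟨n, hn⟩ := h2 x.1 ((H' x.1 : Y ≃ₜ Y) x.2)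
    refine ⟨n, ?_⟩
    have h3 := skewProduct_zpow_apply_of_coboundary S 𝒢
      (H := fun z => (H' z : Y ≃ₜ Y)) hG n x.1 x.2
    rw [show x = (x.1, x.2) from rfl, h3]
    exact hn
  let 𝓑 := TopologicalSpace.countableBasis (Z × Y)
  have h𝓑 : 𝓑.Countable := TopologicalSpace.countable_countableBasis _
  have h𝓑o : ∀ W ∈ 𝓑, IsOpen W := fun W hW => TopologicalSpace.isOpen_of_mem_countableBasis hW
  refine ⟨(⋂ k, (↑) ⁻¹' E k) ∩ ⋂ W ∈ 𝓑, (↑) ⁻¹' V W, ?_, ?_, ?_⟩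
  · exact (IsGδ.iInter fun k => (hEo k).isGδ).inter
      (IsGδ.biInter h𝓑 fun W hW => (hVo W (h𝓑o W hW)).isGδ)
  · refine inter_mem (countable_iInter_mem.2 fun k => residual_of_dense_open (hEo k) (hEd k))
      ((countable_bInter_mem h𝓑).2 fun W hW => residual_of_dense_open (hVo W (h𝓑o W hW))
        (hVd W (h𝓑o W hW) (TopologicalSpace.nonempty_of_mem_countableBasis hW)))
  · rintro G ⟨hGE, hGV⟩
    refine ⟨fun x => ?_, fun δ hδ => ?_⟩
    · refine (TopologicalSpace.isBasis_countableBasis (Z × Y)).dense_iff.2 fun W hW _ => ?_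
      obtain ⟨n, hn⟩ := Set.mem_iInter₂.1 hGV W hW x
      exact ⟨_, hn, n, rfl⟩
    · obtain ⟨k, hk⟩ := exists_nat_one_div_lt hδ
      obtain ⟨N, hN⟩ := Set.mem_iInter.1 hGE k
      exact ⟨N, fun z y y' => (hN z y y').trans_le
        (mul_le_mul_of_nonneg_right hk.le (Nat.cast_nonneg _))⟩

end Generic

/-! ### Baire spaces of cocycles -/

section Baire

open TopologicalSpace

theorem isClosedEmbedding_homeo_prodMk_inv {Y : Type*} [MetricSpace Y] [CompactSpace Y] :
    IsClosedEmbedding fun g : Y ≃ₜ Y =>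
      ((⟨g, g.continuous⟩, ⟨g.symm, g.symm.continuous⟩) : C(Y, Y) × C(Y, Y)) := by
  have hind := isInducing_homeo_toContinuousMap (Y := Y)
  have hcont : Continuous fun g : Y ≃ₜ Y =>
      ((⟨g, g.continuous⟩, ⟨g.symm, g.symm.continuous⟩) : C(Y, Y) × C(Y, Y)) :=
    hind.continuous.prodMk (hind.continuous.comp continuous_inv)
  refine ⟨⟨IsInducing.of_comp hcont continuous_fst hind, fun g h hgh => ?_⟩, ?_⟩
  · exact Homeomorph.ext fun y => DFunLike.congr_fun (congrArg Prod.fst hgh) y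
  · have hrange : Set.range (fun g : Y ≃ₜ Y =>
        ((⟨g, g.continuous⟩, ⟨g.symm, g.symm.continuous⟩) : C(Y, Y) × C(Y, Y))) =
        ⋂ y, {q | q.1 (q.2 y) = y} ∩ {q | q.2 (q.1 y) = y} := by
      ext ⟨a, b⟩
      simp only [Set.mem_range, Set.mem_iInter]
      constructor
      · rintro ⟨g, hg⟩ y
        obtain ⟨rfl, rfl⟩ := Prod.mk.inj hg
        exact ⟨g.apply_symm_apply y, g.symm_apply_apply y⟩
      · intro h
        exact ⟨⟨⟨a, b, fun y => (h y).2, fun y => (h y).1⟩, a.continuous, b.continuous⟩, rfl⟩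
    rw [hrange]
    refine isClosed_iInter fun y => IsClosed.inter ?_ ?_
    · exact isClosed_eq (continuous_fst.eval (continuous_snd.eval continuous_const))
        continuous_const
    · exact isClosed_eq (continuous_snd.eval (continuous_fst.eval continuous_const))
        continuous_const

theorem isCompletelyMetrizableSpace_continuousMap {Z E : Type*} [TopologicalSpace Z]
    [CompactSpace Z] [TopologicalSpace E] [IsCompletelyMetrizableSpace E] :
    IsCompletelyMetrizableSpace C(Z, E) := by
  let := upgradeIsCompletelyMetrizable E
  infer_instance

/-- If `𝒢` is closed in the homeomorphism group then closed sets of cocycles are Baire spaces. The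
uniform metric of the homeomorphism group is not complete, but `g ↦ (g, g⁻¹)` is a closed embedding
into a complete space. -/
theorem baireSpace_closure_of_isClosed {Z Y : Type*} [MetricSpace Z] [CompactSpace Z]
    [MetricSpace Y] [CompactSpace Y] {𝒢 : Subgroup (Y ≃ₜ Y)}
    (h𝒢 : IsClosed (𝒢 : Set (Y ≃ₜ Y))) (A : Set C(Z, 𝒢)) : BaireSpace (closure A) := by
  have h1 : IsCompletelyMetrizableSpace 𝒢 :=
    (isClosedEmbedding_homeo_prodMk_inv.comp
      h𝒢.isClosedEmbedding_subtypeVal).IsCompletelyMetrizableSpace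
  have h2 : IsCompletelyMetrizableSpace C(Z, 𝒢) := isCompletelyMetrizableSpace_continuousMap
  have h3 : IsCompletelyMetrizableSpace (closure A) :=
    (isClosed_closure (s := A)).isClosedEmbedding_subtypeVal.IsCompletelyMetrizableSpace
  infer_instance

end Baire

/-! ### Weyl mean equicontinuity and the maximal equicontinuous factor -/

section Weyl

/-- A function on `ℤ` whose sums over all blocks of length `L` are at most `c * L` has sums at most
`c * p + C * L` over all intervals of length `p`. -/
theorem sum_range_le_of_block_sum_le {f : ℤ → ℝ} {c C : ℝ} {L : ℕ} (hL : 0 < L) (hc : 0 ≤ c)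
    (hC : ∀ i, f i ≤ C) (hC0 : 0 ≤ C)
    (hblock : ∀ i : ℤ, ∑ n ∈ Finset.range L, f (i + n) ≤ c * L) (p : ℕ) (m : ℤ) :
    ∑ k ∈ Finset.range p, f (m + k) ≤ c * p + C * L := by
  induction p using Nat.strong_induction_on generalizing m with
  | _ p ih =>
    rcases lt_or_ge p L with h | h
    · have h1 : ∑ k ∈ Finset.range p, f (m + k) ≤ ∑ k ∈ Finset.range p, C :=
        Finset.sum_le_sum fun k _ => hC _
      rw [Finset.sum_const, Finset.card_range, nsmul_eq_mul] at h1
      have h2 : (p : ℝ) ≤ L := by exact_mod_cast h.le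
      nlinarith [mul_nonneg hc (Nat.cast_nonneg (α := ℝ) p)]
    · obtain ⟨q, rfl⟩ := Nat.exists_eq_add_of_le h
      rw [Finset.sum_range_add]
      have h1 := ih q (by omega) (m + L)
      have h2 := hblock m
      push_cast at h1 ⊢
      simp only [add_assoc] at h1 ⊢
      linarith

theorem sum_Ico_int_eq_sum_range (f : ℤ → ℝ) (m : ℤ) (p : ℕ) :
    ∑ i ∈ Finset.Ico m (m + p), f i = ∑ k ∈ Finset.range p, f (m + k) := by
  rw [Finset.range_eq_Ico, ← Finset.sum_image (s := Finset.Ico 0 p) (g := fun k : ℕ => m + (k : ℤ))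
    (f := f) (fun a _ b _ h => by simpa using h)]
  congr 1
  ext i
  simp only [Finset.mem_Ico, Finset.mem_image]
  constructor
  · rintro ⟨h1, h2⟩
    exact ⟨(i - m).toNat, by omega, by omega⟩
  · rintro ⟨k, hk, rfl⟩
    omega

theorem weylDist_le_of_block_sum_le {X : Type*} [MetricSpace X] [CompactSpace X] {T : X ≃ₜ X}
    {x y : X} {c : ℝ} (hc : 0 ≤ c) {L : ℕ} (hL : 0 < L)
    (hblock : ∀ i : ℤ, ∑ n ∈ Finset.range L,
      dist ((T ^ (i + (n : ℤ))) x) ((T ^ (i + (n : ℤ))) y) ≤ c * L)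
    {c' : ℝ} (hc' : c < c') : weylDist T x y ≤ c' := by
  set C : ℝ := Metric.diam (Set.univ : Set X) with hC
  have hdiam : ∀ a b : X, dist a b ≤ C := fun a b =>
    Metric.dist_le_diam_of_mem isCompact_univ.isBounded (Set.mem_univ a) (Set.mem_univ b)
  have hC0 : 0 ≤ C := Metric.diam_nonneg
  have hne : (comap (fun p : ℤ × ℤ => p.2 - p.1) atTop).NeBot :=
    atTop_neBot.comap_of_surj fun n => ⟨(0, n), by simp⟩
  obtain ⟨K, hK⟩ := exists_nat_gt (C * L / (c' - c))
  have hev : ∀ᶠ p : ℤ × ℤ in comap (fun p : ℤ × ℤ => p.2 - p.1) atTop, (K + 1 : ℤ) ≤ p.2 - p.1 :=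
    tendsto_comap.eventually (eventually_ge_atTop _)
  refine limsup_le_of_le (isCoboundedUnder_le_of_eventually_le (x := 0) _
    (hev.mono fun p hp => ?_)) (hev.mono fun p hp => ?_)
  · have h1 : (0 : ℝ) ≤ (p.2 : ℝ) - p.1 := by exact_mod_cast (by omega : 0 ≤ p.2 - p.1)
    exact div_nonneg (Finset.sum_nonneg fun i _ => dist_nonneg) h1
  · obtain ⟨m, n⟩ := p
    obtain ⟨q, hq⟩ : ∃ q : ℕ, n = m + q := ⟨(n - m).toNat, by simp at hp; omega⟩
    subst hq
    have hKq : (K : ℝ) < q := by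
      have : (K : ℤ) < q := by simp at hp; omega
      exact_mod_cast this
    have hq0 : (0 : ℝ) < q := (Nat.cast_nonneg K).trans_lt hKq
    have h1 := sum_range_le_of_block_sum_le
      (f := fun i => dist ((T ^ i) x) ((T ^ i) y)) hL hc (fun i => hdiam _ _) hC0 hblock q m
    simp only
    rw [sum_Ico_int_eq_sum_range (fun i => dist ((T ^ i) x) ((T ^ i) y))]
    rw [show (((m + q : ℤ) : ℝ) - (m : ℝ)) = q by push_cast; ring, div_le_iff₀ hq0]
    have h2 : C * L < q * (c' - c) := (div_lt_iff₀ (sub_pos.2 hc')).1 (hK.trans hKq)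
    linarith

variable {Z Y : Type*} [MetricSpace Z] [CompactSpace Z] [MetricSpace Y] [CompactSpace Y]
  {S : Z ≃ₜ Z} {T : (Z × Y) ≃ₜ (Z × Y)}

theorem isometry_zpow {Z : Type*} [MetricSpace Z] {S : Z ≃ₜ Z} (hS : Isometry S) (n : ℤ) :
    Isometry (S ^ n : Z ≃ₜ Z) := by
  induction n using Int.induction_on with
  | zero => exact isometry_id
  | succ n ih => rw [zpow_add_one]; exact ih.comp hS
  | pred n ih =>
    rw [zpow_sub_one]
    exact ih.comp (hS.right_inv S.apply_symm_apply)

/-- An extension with collapsing fibers of an isometric system is Weyl mean equicontinuous: along an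
orbit segment of fixed length, points of nearby fibers stay close on average to the orbits of a
horizontal section. -/
theorem FibersCollapse.isWeylMeanEquicontinuous [Nonempty Y] (hS : Isometry S)
    (hT : ∀ x, (T x).1 = S x.1) (hc : FibersCollapse T) : IsWeylMeanEquicontinuous T := by
  intro ε hε
  obtain ⟨N, hN⟩ := hc (ε / 8) (by positivity)
  obtain ⟨y₀⟩ := ‹Nonempty Y›
  have hsec : ∀ n ∈ Finset.range (N + 1), ∀ᶠ ρ in 𝓝[>] (0 : ℝ), ∀ z z', dist z z' < ρ →
      dist ((T ^ n) (z, y₀)).2 ((T ^ n) (z', y₀)).2 < ε / 8 := by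
    intro n _
    have hcont : Continuous fun z => ((T ^ n) (z, y₀)).2 := by fun_prop
    obtain ⟨ρ, hρ, h⟩ := Metric.uniformContinuous_iff.1
      (CompactSpace.uniformContinuous_of_continuous hcont) (ε / 8) (by positivity)
    filter_upwards [Ioo_mem_nhdsGT hρ] with r hr z z' hz
    exact h (hz.trans hr.2)
  obtain ⟨ρ, ⟨hρ, hρε⟩, hρ0⟩ := ((((Filter.eventually_all_finset _).2 hsec).and
    (Ioo_mem_nhdsGT (show 0 < ε / 8 by positivity))).and self_mem_nhdsWithin).exists
  refine ⟨ρ, hρ0, fun x x' hx => ?_⟩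
  have hblock : ∀ w w' : Z × Y, dist w.1 w'.1 < ρ → ∑ n ∈ Finset.range (N + 1),
      dist ((T ^ n) w) ((T ^ n) w') ≤ ε / 2 * ((N + 1 : ℕ) : ℝ) := by
    intro w w' hw
    have h1 : ∀ n ∈ Finset.range (N + 1), dist ((T ^ n) w) ((T ^ n) w') ≤
        dist ((T ^ n) (w.1, w.2)).2 ((T ^ n) (w.1, y₀)).2 +
          dist ((T ^ n) (w'.1, w'.2)).2 ((T ^ n) (w'.1, y₀)).2 + ε / 4 := by
      intro n hn
      have h2 : dist ((T ^ n) w).1 ((T ^ n) w').1 < ε / 8 := by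
        have e : ∀ w : Z × Y, ((T ^ n) w).1 = (S ^ n) w.1 := fun w =>
          zpow_apply_fst_of_semiconj hT n w
        rw [e, e]
        exact ((isometry_zpow hS n).dist_eq _ _).trans_lt (hw.trans hρε.2)
      have h3 := hρ n hn _ _ hw
      have h4 := dist_triangle4 ((T ^ n) w).2 ((T ^ n) (w.1, y₀)).2 ((T ^ n) (w'.1, y₀)).2
        ((T ^ n) w').2
      rw [dist_comm ((T ^ n) (w'.1, y₀)).2] at h4
      rw [Prod.dist_eq, Prod.mk.eta, Prod.mk.eta]
      have d1 : 0 ≤ dist ((T ^ n) w).2 ((T ^ n) (w.1, y₀)).2 := dist_nonneg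
      have d2 : 0 ≤ dist ((T ^ n) w').2 ((T ^ n) (w'.1, y₀)).2 := dist_nonneg
      exact max_le (by linarith) (by linarith)
    have h5 := Finset.sum_le_sum h1
    rw [Finset.sum_add_distrib, Finset.sum_add_distrib, Finset.sum_const, Finset.card_range,
      nsmul_eq_mul] at h5
    have h6 := hN w.1 w.2 y₀
    have h7 := hN w'.1 w'.2 y₀
    linarith
  refine (weylDist_le_of_block_sum_le (c := ε / 2) (by positivity) (Nat.succ_pos N) (fun i => ?_)
    (c' := 3 * ε / 4) (by linarith)).trans_lt (by linarith)
  have h8 : dist ((T ^ i) x).1 ((T ^ i) x').1 < ρ := by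
    rw [zpow_apply_fst_of_semiconj hT, zpow_apply_fst_of_semiconj hT,
      (isometry_zpow hS i).dist_eq]
    exact lt_of_le_of_lt (le_max_left _ _) hx
  have h9 : ∀ (n : ℕ) (w : Z × Y), (T ^ (i + (n : ℤ))) w = (T ^ n) ((T ^ i) w) := by
    intro n w
    rw [add_comm, zpow_add, zpow_natCast]
    rfl
  simp only [h9]
  exact hblock _ _ h8

/-- Equicontinuous factors do not separate points of a collapsing fiber, because such points are
proximal. -/
theorem FibersCollapse.factor_eq {Z' : Type*} [MetricSpace Z'] [CompactSpace Z'] {S' : Z' ≃ₜ Z'}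
    {π : Z × Y → Z'} (hT : ∀ x, (T x).1 = S x.1) (hc : FibersCollapse T)
    (hπ : IsFactorMap T S' π) (hS' : IsEquicontinuousSystem S') (z : Z) (y y' : Y) :
    π (z, y) = π (z, y') := by
  by_contra hne
  obtain ⟨δ, hδ, heq⟩ := Metric.uniformEquicontinuous_iff.1
    (CompactSpace.uniformEquicontinuous_of_equicontinuous hS') _ (dist_pos.2 hne)
  obtain ⟨ρ, hρ, hunif⟩ := Metric.uniformContinuous_iff.1
    (CompactSpace.uniformContinuous_of_continuous hπ.1) δ hδ
  obtain ⟨N, hN⟩ := hc ρ hρ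
  obtain ⟨n, hn⟩ : ∃ n : ℕ, dist ((T ^ n) (z, y)).2 ((T ^ n) (z, y')).2 < ρ := by
    by_contra! hcon
    have h1 := Finset.card_nsmul_le_sum (Finset.range (N + 1))
      (fun n => dist ((T ^ n) (z, y)).2 ((T ^ n) (z, y')).2) ρ fun n _ => hcon n
    rw [Finset.card_range, nsmul_eq_mul, mul_comm] at h1
    exact absurd (hN z y y') (not_lt.2 h1)
  have hpow : ∀ (n : ℕ) (x : Z × Y), π ((T ^ n) x) = (S' ^ n) (π x) := by
    intro n
    induction n with
    | zero => exact fun x => rfl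
    | succ n ih =>
      intro x
      rw [pow_succ, pow_succ]
      exact (ih (T x)).trans (congrArg (S' ^ n) (hπ.2.2 x))
  have hfst : ((T ^ n) (z, y)).1 = ((T ^ n) (z, y')).1 := by
    have e : ∀ w : Z × Y, ((T ^ n) w).1 = (S ^ n) w.1 := fun w =>
      zpow_apply_fst_of_semiconj hT n w
    rw [e, e]
  have hd : dist ((T ^ n) (z, y)) ((T ^ n) (z, y')) < ρ := by
    rw [Prod.dist_eq, hfst, dist_self, max_eq_right dist_nonneg]
    exact hn
  have h1 := heq _ _ (hunif hd) (-(n : ℤ))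
  have hback : ∀ w, (S' ^ (-(n : ℤ))) ((S' ^ n) w) = w := by
    intro w
    rw [zpow_neg, zpow_natCast]
    exact (S' ^ n).symm_apply_apply w
  simp only [hpow, hback] at h1
  exact lt_irrefl _ h1

theorem isEquicontinuousSystem_of_isometry {Z : Type*} [MetricSpace Z] {S : Z ≃ₜ Z}
    (hS : Isometry S) : IsEquicontinuousSystem S := by
  refine (Metric.uniformEquicontinuous_iff.2 fun ε hε => ⟨ε, hε, fun x y h n => ?_⟩).equicontinuous
  exact ((isometry_zpow hS n).dist_eq x y).trans_lt h

theorem FibersCollapse.isMaximalEquicontinuousFactor {Z Y : Type u} [MetricSpace Z]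
    [CompactSpace Z] [MetricSpace Y] [CompactSpace Y] [Nonempty Y] {S : Z ≃ₜ Z}
    {T : (Z × Y) ≃ₜ (Z × Y)} (hT : ∀ x, (T x).1 = S x.1) (hc : FibersCollapse T)
    (hS : IsEquicontinuousSystem S) : IsMaximalEquicontinuousFactor T S Prod.fst := by
  obtain ⟨y₀⟩ := ‹Nonempty Y›
  refine ⟨⟨continuous_fst, fun z => ⟨(z, y₀), rfl⟩, hT⟩, hS, ?_⟩
  intro Z' _ _ S' π hπ hS'
  have hθ : ∀ x, π x = π (x.1, y₀) := fun x => hc.factor_eq hT hπ hS' x.1 x.2 y₀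
  refine ⟨fun z => π (z, y₀), ⟨hπ.1.comp (Continuous.prodMk_left y₀), fun w => ?_, fun z => ?_⟩, hθ⟩
  · obtain ⟨x, rfl⟩ := hπ.2.1 w
    exact ⟨x.1, (hθ x).symm⟩
  · rw [← hπ.2.2, hθ (T (z, y₀)), hT]

theorem FibersCollapse.not_isAlmostOneToOneExtension [Nonempty Z] [Nontrivial Y]
    (hT : ∀ x, (T x).1 = S x.1) (hc : FibersCollapse T) (hS : IsEquicontinuousSystem S) :
    ¬ IsAlmostOneToOneExtension T S := by
  rintro ⟨π, hπ, hd⟩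
  obtain ⟨x, hx⟩ := hd.nonempty
  obtain ⟨y', hy'⟩ := exists_ne x.2
  exact hy' (congrArg Prod.snd (hx (x.1, y') (hc.factor_eq hT hπ hS x.1 y' x.2)))

end Weyl

/-! ### Rotations of monothetic groups -/

section Rotation

variable {Z : Type*} [AddCommGroup Z] [MetricSpace Z] [IsTopologicalAddGroup Z]

theorem addLeft_zpow_apply (a : Z) (n : ℤ) (z : Z) : (Homeomorph.addLeft a ^ n) z = n • a + z := by
  induction n using Int.induction_on generalizing z with
  | zero => simp
  | succ n ih =>
    rw [zpow_add_one]
    refine (ih (a + z)).trans ?_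
    rw [add_smul, one_smul, add_assoc]
  | pred n ih =>
    rw [zpow_sub_one]
    refine (ih (-a + z)).trans ?_
    rw [sub_smul, one_smul, sub_eq_add_neg, add_assoc]

theorem isMinimalSystem_addLeft {a : Z} (ha : DenseRange fun n : ℤ => n • a) :
    IsMinimalSystem (Homeomorph.addLeft a) := by
  intro z
  have h : (fun n : ℤ => (Homeomorph.addLeft a ^ n) z) =
      (Homeomorph.addRight z) ∘ fun n : ℤ => n • a := funext fun n => addLeft_zpow_apply a n z
  rw [h]
  exact (Homeomorph.addRight z).surjective.denseRange.comp ha (Homeomorph.addRight z).continuous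

/-- A rotation of a compact group by a topological generator is strictly ergodic: an invariant
measure is invariant under the dense subgroup of multiples of the generator, hence is the Haar
measure. -/
theorem isStrictlyErgodic_addLeft [CompactSpace Z] [MeasurableSpace Z] [BorelSpace Z] {a : Z}
    (ha : DenseRange fun n : ℤ => n • a) : IsStrictlyErgodic (Homeomorph.addLeft a) := by
  refine ⟨isMinimalSystem_addLeft ha, ?_⟩
  have hhaar : ∀ μ : ProbabilityMeasure Z, MeasurePreserving (Homeomorph.addLeft a)
      (μ : Measure Z) μ → (μ : Measure Z).IsAddHaarMeasure := by
    intro μ hμ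
    have hinv : (μ : Measure Z).IsAddLeftInvariant := by
      refine ⟨fun g => ?_⟩
      have : IsProbabilityMeasure (Measure.map (g + ·) (μ : Measure Z)) :=
        Measure.isProbabilityMeasure_map (by fun_prop)
      refine ext_of_forall_integral_eq_of_IsFiniteMeasure fun f => ?_
      rw [integral_map (by fun_prop) (by fun_prop)]
      have hcont : Continuous fun g : Z => ∫ x, f (g + x) ∂(μ : Measure Z) := by
        refine continuous_of_dominated (bound := fun _ => ‖f‖) (fun g => ?_) (fun g => ?_)
          (integrable_const _) ?_
        · exact (f.continuous.comp (continuous_const.add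
            continuous_id)).measurable.aestronglyMeasurable
        · exact Eventually.of_forall fun x => f.norm_coe_le_norm _
        · exact Eventually.of_forall fun x => f.continuous.comp (continuous_id.add continuous_const)
      have heq := ha.equalizer hcont (continuous_const (y := ∫ x, f x ∂(μ : Measure Z)))
        (funext fun n => ?_)
      · exact congrFun heq g
      · have h1 := (measurePreserving_homeo_zpow hμ n).integral_comp
          (Homeomorph.addLeft a ^ n).measurableEmbedding f
        simp only [addLeft_zpow_apply] at h1
        exact h1
    exact Measure.isAddHaarMeasure_of_isCompact_nonempty_interior _ Set.univ isCompact_univ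
      (by simp) (by simp) (by simp)
  obtain ⟨μ, hμ, -⟩ := exists_invariant_of_averages (Homeomorph.addLeft a) (fun _ => 0) tendsto_id
  refine ⟨μ, fun μ' => ⟨fun hμ' => ?_, ?_⟩⟩
  · have h1 := hhaar μ hμ
    have h2 := hhaar μ' hμ'
    exact Subtype.ext (Measure.isAddHaarMeasure_eq_of_isProbabilityMeasure
      (μ' : Measure Z) (μ : Measure Z))
  · rintro rfl
    exact hμ

end Rotation

/-! ### The Möbius group of the circle -/

section Moebius

/-- The subgroup generated by a path connected set containing the identity is path connected. -/
theorem isPathConnected_subgroup_closure {G : Type*} [Group G] [TopologicalSpace G]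
    [IsTopologicalGroup G] {P : Set G} (hP : IsPathConnected P) (h1 : 1 ∈ P) :
    IsPathConnected (Subgroup.closure P : Set G) := by
  refine ⟨1, Subgroup.one_mem _, fun {g} hg => ?_⟩
  induction hg using Subgroup.closure_induction with
  | mem x hx => exact (hP.joinedIn 1 h1 x hx).mono Subgroup.subset_closure
  | one => exact JoinedIn.refl (Subgroup.one_mem _)
  | mul x y _ _ hx hy =>
    have h := hx.mul hy
    rw [one_mul] at h
    exact h.mono (Set.mul_subset_iff.2 fun a ha b hb => Subgroup.mul_mem _ ha hb)
  | inv x _ hx =>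
    have h := hx.inv
    rw [inv_one] at h
    exact h.mono fun a ha => by
      simpa using (Subgroup.closure P).inv_mem (show a⁻¹ ∈ Subgroup.closure P from ha)

/-- The parameters of the hyperbolic Möbius transformations fixing `1` and `-1`. -/
abbrev HyperbolicParameter : Type := Set.Ioo (-1 : ℝ) 1

theorem one_add_mul_circle_ne_zero (s : HyperbolicParameter) (z : Circle) :
    (1 + (s : ℝ) * (z : ℂ)) ≠ 0 := by
  intro h
  have h1 : ((s : ℝ) : ℂ) * z = -1 := by linear_combination h
  have h2 := congrArg norm h1
  rw [norm_mul, Circle.norm_coe, mul_one, norm_neg, norm_one, Complex.norm_real,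
    Real.norm_eq_abs] at h2
  exact absurd h2 (abs_lt.2 s.2).ne

theorem norm_hyperbolic (s : HyperbolicParameter) (z : Circle) :
    ‖((z : ℂ) + (s : ℝ)) / (1 + (s : ℝ) * (z : ℂ))‖ = 1 := by
  have h0 := norm_ne_zero_iff.2 (one_add_mul_circle_ne_zero s z)
  rw [norm_div, div_eq_one_iff_eq h0]
  have hz : (z : ℂ) * (starRingEnd ℂ) (z : ℂ) = 1 := by
    rw [Complex.mul_conj, Circle.normSq_coe, Complex.ofReal_one]
  calc ‖(z : ℂ) + (s : ℝ)‖ = ‖(starRingEnd ℂ) ((z : ℂ) + (s : ℝ))‖ := (Complex.norm_conj _).symm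
    _ = ‖(z : ℂ)‖ * ‖(starRingEnd ℂ) ((z : ℂ) + (s : ℝ))‖ := by rw [Circle.norm_coe, one_mul]
    _ = ‖1 + (s : ℝ) * (z : ℂ)‖ := by
      rw [← norm_mul, map_add, Complex.conj_ofReal, mul_add, hz, mul_comm (z : ℂ)]

/-- The hyperbolic Möbius transformation `z ↦ (z + s) / (1 + s z)` of the circle, as a map. -/
noncomputable def hyperbolicFun (s : HyperbolicParameter) (z : Circle) : Circle :=
  ⟨((z : ℂ) + (s : ℝ)) / (1 + (s : ℝ) * (z : ℂ)), mem_sphere_zero_iff_norm.2 (norm_hyperbolic s z)⟩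

theorem coe_hyperbolicFun (s : HyperbolicParameter) (z : Circle) :
    (hyperbolicFun s z : ℂ) = ((z : ℂ) + (s : ℝ)) / (1 + (s : ℝ) * (z : ℂ)) := rfl

theorem isInducing_circle_coe : IsInducing ((↑) : Circle → ℂ) := ⟨rfl⟩

theorem continuous_hyperbolicFun :
    Continuous fun p : HyperbolicParameter × Circle => hyperbolicFun p.1 p.2 := by
  refine isInducing_circle_coe.continuous_iff.2
    (Continuous.div ?_ ?_ fun p => one_add_mul_circle_ne_zero p.1 p.2)
  · exact (isInducing_circle_coe.continuous.comp continuous_snd).add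
      (Complex.continuous_ofReal.comp (continuous_subtype_val.comp continuous_fst))
  · exact continuous_const.add ((Complex.continuous_ofReal.comp
      (continuous_subtype_val.comp continuous_fst)).mul
        (isInducing_circle_coe.continuous.comp continuous_snd))

/-- The parameter of the inverse transformation. -/
def HyperbolicParameter.neg (s : HyperbolicParameter) : HyperbolicParameter :=
  ⟨-s, by have := s.2.2; linarith, by have := s.2.1; linarith⟩

theorem hyperbolicFun_neg_apply (s : HyperbolicParameter) (z : Circle) :
    hyperbolicFun s.neg (hyperbolicFun s z) = z := by
  have h0 := one_add_mul_circle_ne_zero s z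
  have h1 := one_add_mul_circle_ne_zero s.neg (hyperbolicFun s z)
  refine Subtype.ext ?_
  rw [coe_hyperbolicFun, div_eq_iff h1, coe_hyperbolicFun]
  simp only [HyperbolicParameter.neg, Complex.ofReal_neg]
  have key : ∀ a b : ℂ, 1 + b * a ≠ 0 →
      (a + b) / (1 + b * a) + -b = a * (1 + -b * ((a + b) / (1 + b * a))) := by
    intro a b h
    rw [mul_comm b a] at h
    rw [mul_comm b a]
    field_simp
    ring
  exact key _ _ h0

/-- The Möbius transformation `z ↦ c (z + s) / (1 + s z)` of the circle. -/
noncomputable def moebius (p : Circle × HyperbolicParameter) : Circle ≃ₜ Circle where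
  toFun z := p.1 * hyperbolicFun p.2 z
  invFun z := hyperbolicFun p.2.neg (p.1⁻¹ * z)
  left_inv z := by
    change hyperbolicFun p.2.neg (p.1⁻¹ * (p.1 * hyperbolicFun p.2 z)) = z
    rw [inv_mul_cancel_left, hyperbolicFun_neg_apply]
  right_inv z := by
    have h := hyperbolicFun_neg_apply p.2.neg (p.1⁻¹ * z)
    have hs : p.2.neg.neg = p.2 := Subtype.ext (neg_neg _)
    rw [hs] at h
    change p.1 * hyperbolicFun p.2 (hyperbolicFun p.2.neg (p.1⁻¹ * z)) = z
    rw [h, mul_inv_cancel_left]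
  continuous_toFun := continuous_const.mul
    (continuous_hyperbolicFun.comp (Continuous.prodMk_right p.2))
  continuous_invFun := continuous_hyperbolicFun.comp
    (continuous_const.prodMk (continuous_const.mul continuous_id))

theorem moebius_apply (p : Circle × HyperbolicParameter) (z : Circle) :
    moebius p z = p.1 * hyperbolicFun p.2 z := rfl

/-- The group of homeomorphisms of the circle generated by the Möbius transformations
`z ↦ c (z + s) / (1 + s z)`. -/
noncomputable def moebiusGroup : Subgroup (Circle ≃ₜ Circle) :=
  Subgroup.closure (Set.range moebius)

theorem hyperbolicFun_zero (z : Circle) :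
    hyperbolicFun ⟨0, by norm_num⟩ z = z := by
  refine Subtype.ext ?_
  rw [coe_hyperbolicFun]
  simp

theorem isPathConnected_moebiusGroup :
    IsPathConnected (moebiusGroup : Set (Circle ≃ₜ Circle)) := by
  have hpc : PathConnectedSpace HyperbolicParameter :=
    isPathConnected_iff_pathConnectedSpace.1
      ((convex_Ioo (-1 : ℝ) 1).isPathConnected ⟨0, by norm_num⟩)
  refine isPathConnected_subgroup_closure (isPathConnected_range ?_) ⟨(1, ⟨0, by norm_num⟩), ?_⟩
  · refine continuous_homeo_of_uncurry ?_
    exact (continuous_fst.comp continuous_fst).mul (continuous_hyperbolicFun.comp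
      ((continuous_snd.comp continuous_fst).prodMk continuous_snd))
  · refine Homeomorph.ext fun z => ?_
    rw [moebius_apply, one_mul, hyperbolicFun_zero]
    rfl

/-- As `s → -1`, the transformation `z ↦ (z + s) / (1 + s z)` pushes everything away from its
repelling fixed point `1` to its attracting fixed point `-1`. -/
theorem norm_hyperbolicFun_add_one_le (s : HyperbolicParameter) (z : Circle) {r : ℝ}
    (hz : r ≤ ‖(z : ℂ) - 1‖) (hs : 1 + (s : ℝ) ≤ r / 2) (hr : 0 < r) :
    ‖(hyperbolicFun s z : ℂ) + 1‖ ≤ 4 * (1 + (s : ℝ)) / r := by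
  have h0 := one_add_mul_circle_ne_zero s z
  have hs0 : 0 < 1 + (s : ℝ) := by linarith [s.2.1]
  have h1 : (hyperbolicFun s z : ℂ) + 1 =
      ((1 + (s : ℝ) : ℝ) : ℂ) * (1 + z) / (1 + (s : ℝ) * (z : ℂ)) := by
    have key : ∀ a b : ℂ, 1 + b * a ≠ 0 →
        (a + b) / (1 + b * a) + 1 = (1 + b) * (1 + a) / (1 + b * a) := by
      intro a b h
      rw [mul_comm b a] at h
      rw [mul_comm b a]
      field_simp
      ring
    rw [coe_hyperbolicFun]
    push_cast
    exact key _ _ h0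
  have h2 : r / 2 ≤ ‖1 + (s : ℝ) * (z : ℂ)‖ := by
    have h3 : (z : ℂ) - 1 = ((1 + (s : ℝ) : ℝ) : ℂ) * z - (1 + (s : ℝ) * (z : ℂ)) := by
      push_cast
      ring
    have h4 := norm_sub_le (((1 + (s : ℝ) : ℝ) : ℂ) * z) (1 + (s : ℝ) * (z : ℂ))
    rw [← h3, norm_mul, Circle.norm_coe, mul_one, Complex.norm_real, Real.norm_eq_abs,
      abs_of_pos hs0] at h4
    linarith
  have h5 : ‖1 + (z : ℂ)‖ ≤ 2 := by
    refine (norm_add_le _ _).trans ?_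
    rw [norm_one, Circle.norm_coe]
    norm_num
  rw [h1, norm_div, norm_mul, Complex.norm_real, Real.norm_eq_abs, abs_of_pos hs0]
  calc (1 + (s : ℝ)) * ‖1 + (z : ℂ)‖ / ‖1 + (s : ℝ) * (z : ℂ)‖
      ≤ (1 + (s : ℝ)) * 2 / (r / 2) := by gcongr
    _ = 4 * (1 + (s : ℝ)) / r := by field_simp; ring

theorem dist_circle_eq_norm (z w : Circle) : dist z w = ‖(z : ℂ) - w‖ :=
  dist_eq_norm_sub (z : ℂ) w

/-- The Möbius group satisfies condition (A): the complement of an open set can be squeezed into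
arbitrarily many pairwise disjoint sets. -/
theorem conditionA_moebiusGroup : ConditionA moebiusGroup := by
  intro V hV ⟨v, hv⟩ ε hε
  obtain ⟨r, hr, hball⟩ := Metric.isOpen_iff.1 hV v hv
  obtain ⟨m, hm⟩ := exists_nat_one_div_lt hε
  have hinf : Infinite Circle := by
    have := (Set.Ioc_infinite (show -Real.pi < Real.pi by linarith [Real.pi_pos])).to_subtype
    refine Infinite.of_injective (fun x : Set.Ioc (-Real.pi) Real.pi => Circle.exp x) ?_
    intro x y hxy
    exact Subtype.ext (Circle.exp_injOn_Ioc (by linarith) x.2 y.2 hxy)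
  let c : Fin (m + 1) → Circle := fun j => Infinite.natEmbedding Circle j
  have hc : Function.Injective c := fun i j h =>
    Fin.ext ((Infinite.natEmbedding Circle).injective h)
  obtain ⟨d, hd, hcd⟩ : ∃ d > 0, ∀ i j, i ≠ j → d < dist (c i) (c j) := by
    have h : ∀ᶠ d in 𝓝[>] (0 : ℝ), ∀ i j, i ≠ j → d < dist (c i) (c j) := by
      refine Filter.eventually_all.2 fun i => Filter.eventually_all.2 fun j => ?_
      by_cases hij : i = j
      · exact Eventually.of_forall fun _ h => absurd hij h
      · filter_upwards [Ioo_mem_nhdsGT (dist_pos.2 (hc.ne hij))] with d hd _ using hd.2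
    obtain ⟨d, hd, hd0⟩ := (h.and self_mem_nhdsWithin).exists
    exact ⟨d, hd0, hd⟩
  -- the parameter is so close to `-1` that images are within `d / 2` of the attracting points
  obtain ⟨s, hs1, hs2⟩ : ∃ s : HyperbolicParameter,
      1 + (s : ℝ) ≤ r / 2 ∧ 4 * (1 + (s : ℝ)) / r ≤ d / 2 := by
    have hpos : 0 < min (min (r / 2) (d * r / 8)) 1 := by positivity
    refine ⟨⟨min (min (r / 2) (d * r / 8)) 1 - 1, by linarith, ?_⟩, ?_, ?_⟩
    · linarith [min_le_right (min (r / 2) (d * r / 8)) 1]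
    · have := (min_le_left (min (r / 2) (d * r / 8)) 1).trans (min_le_left _ _)
      simp [this]
    · have := (min_le_left (min (r / 2) (d * r / 8)) 1).trans (min_le_right _ _)
      rw [div_le_iff₀ hr]
      simp only [add_sub_cancel]
      linarith
  let h : Fin (m + 1) → (Circle ≃ₜ Circle) := fun j =>
    moebius (c j, s) * moebius (v⁻¹, ⟨0, by norm_num⟩)
  have hmem : ∀ j, h j ∈ moebiusGroup := fun j => Subgroup.mul_mem _
    (Subgroup.subset_closure ⟨_, rfl⟩) (Subgroup.subset_closure ⟨_, rfl⟩)
  have hclose : ∀ j, ∀ y ∈ h j '' Vᶜ, ‖(y : ℂ) + c j‖ ≤ d / 2 := by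
    rintro j _ ⟨z, hz, rfl⟩
    have h1 : h j z = c j * hyperbolicFun s (v⁻¹ * z) := by
      change moebius (c j, s) (moebius (v⁻¹, _) z) = _
      rw [moebius_apply, moebius_apply, hyperbolicFun_zero]
    have h2 : r ≤ ‖((v⁻¹ * z : Circle) : ℂ) - 1‖ := by
      by_contra! hlt
      refine hz (hball ?_)
      have h3 : (z : ℂ) - v = v * (((v⁻¹ * z : Circle) : ℂ) - 1) := by
        rw [mul_sub, ← Circle.coe_mul, mul_inv_cancel_left, mul_one]
      rwa [Metric.mem_ball, dist_circle_eq_norm, h3, norm_mul, Circle.norm_coe, one_mul]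
    have h4 := (norm_hyperbolicFun_add_one_le s _ h2 hs1 hr).trans hs2
    rw [h1, Circle.coe_mul]
    rwa [show (c j : ℂ) * (hyperbolicFun s (v⁻¹ * z) : ℂ) + c j =
      c j * ((hyperbolicFun s (v⁻¹ * z) : ℂ) + 1) by ring, norm_mul, Circle.norm_coe, one_mul]
  have hdisj : ∀ y i j, y ∈ h i '' Vᶜ → y ∈ h j '' Vᶜ → i = j := by
    intro y i j hi hj
    by_contra hij
    have h1 := hcd i j hij
    have h2 : dist (c i) (c j) = ‖((y : ℂ) + c i) - ((y : ℂ) + c j)‖ := by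
      rw [add_sub_add_left_eq_sub, dist_circle_eq_norm]
    have h3 := norm_sub_le ((y : ℂ) + c i) ((y : ℂ) + c j)
    linarith [hclose i y hi, hclose j y hj]
  refine ⟨m + 1, Nat.succ_pos m, h, hmem, fun y => ?_⟩
  classical
  have hsum : ∑ j, Set.indicator (h j '' Vᶜ) (fun _ => (1 : ℝ)) y ≤ 1 := by
    have h1 : ∀ j, Set.indicator (h j '' Vᶜ) (fun _ => (1 : ℝ)) y =
        if y ∈ h j '' Vᶜ then 1 else 0 := fun j => Set.indicator_apply _ _ _
    simp only [h1]
    rw [Finset.sum_boole]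
    have h2 : (Finset.univ.filter fun j => y ∈ h j '' Vᶜ).card ≤ 1 :=
      Finset.card_le_one.2 fun i hi j hj =>
        hdisj y i j (Finset.mem_filter.1 hi).2 (Finset.mem_filter.1 hj).2
    exact_mod_cast h2
  have hm' : 1 / ((m + 1 : ℕ) : ℝ) < ε := by simpa using hm
  have hm0 : 0 ≤ 1 / ((m + 1 : ℕ) : ℝ) := by positivity
  nlinarith

end Moebius

/-! ### Generic isomorphic extensions and an extension that is not almost one-to-one -/

theorem theorem3p1 :
    -- for every infinite strictly ergodic system and every such group, a generic cocycle in the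
    -- closure of the coboundaries gives a minimal isomorphic extension
    (∀ (Z : Type u) [MetricSpace Z] [CompactSpace Z] [MeasurableSpace Z] [BorelSpace Z] [Infinite Z]
        (Y : Type v) [MetricSpace Y] [CompactSpace Y] [MeasurableSpace Y] [BorelSpace Y] [Nonempty Y]
        (S : Z ≃ₜ Z) (𝒢 : Subgroup (Y ≃ₜ Y)),
        IsStrictlyErgodic S → IsPathConnected (𝒢 : Set (Y ≃ₜ Y)) → ConditionA 𝒢 →
        ∃ R : Set (closure (coboundaries S 𝒢)),
          R ∈ residual (closure (coboundaries S 𝒢)) ∧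
          (IsClosed (𝒢 : Set (Y ≃ₜ Y)) → ∃ D ⊆ R, IsGδ D ∧ Dense D) ∧
          ∀ G ∈ R,
            IsMinimalSystem (skewProduct S 𝒢 (G : C(Z, 𝒢))) ∧
            IsIsomorphicExtensionVia (skewProduct S 𝒢 (G : C(Z, 𝒢))) S Prod.fst) ∧
    -- there is a minimal, Weyl mean equicontinuous isomorphic extension of its maximal
    -- equicontinuous factor which is not an almost one-to-one extension of it
    (∃ (X Z : Type) (_ : MetricSpace X) (_ : CompactSpace X) (_ : MeasurableSpace X)
        (_ : BorelSpace X) (_ : Infinite X) (_ : MetricSpace Z) (_ : CompactSpace Z)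
        (_ : MeasurableSpace Z) (_ : BorelSpace Z) (_ : Infinite Z)
        (T : X ≃ₜ X) (S : Z ≃ₜ Z) (π : X → Z),
        IsMinimalSystem T ∧ IsWeylMeanEquicontinuous T ∧
        IsMaximalEquicontinuousFactor T S π ∧ IsIsomorphicExtensionVia T S π ∧
        ¬ IsAlmostOneToOneExtension T S) := by
  refine ⟨?_, ?_⟩
  · intro Z _ _ _ _ _ Y _ _ _ _ _ S 𝒢 hS hp hA
    have hmem : ∀ G, G ∈ coboundaries S 𝒢 ↔
        ∃ H : C(Z, 𝒢), ∀ z, (G z : Y ≃ₜ Y) = (H (S z) : Y ≃ₜ Y)⁻¹ * H z := fun G =>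
      exists_congr fun H => forall_congr' fun z => Subtype.ext_iff
    obtain ⟨R, hRδ, hR, hgood⟩ := exists_generic_minimal_collapsing hS le_rfl hp hA hmem
    refine ⟨R, hR, fun hclosed => ⟨R, subset_rfl, hRδ, ?_⟩, fun G hG => ⟨(hgood G hG).1,
      (hgood G hG).2.isIsomorphicExtensionVia hS.2 fun x => rfl⟩⟩
    have := baireSpace_closure_of_isClosed hclosed (coboundaries S 𝒢)
    exact dense_of_mem_residual hR
  · -- cocycles over the dyadic odometer with values in all homeomorphisms of the circle, which
    -- form a closed group, in the closure of the coboundaries of the Möbius group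
    let : MeasurableSpace ℤ_[2] := borel _
    have : BorelSpace ℤ_[2] := ⟨rfl⟩
    let : MeasurableSpace Circle := borel _
    have : BorelSpace Circle := ⟨rfl⟩
    let S : ℤ_[2] ≃ₜ ℤ_[2] := Homeomorph.addLeft 1
    have hiso : Isometry S := isometry_add_left 1
    have hS : IsStrictlyErgodic S := isStrictlyErgodic_addLeft (by
      simpa only [zsmul_one] using PadicInt.denseRange_intCast)
    let A : Set C(ℤ_[2], (⊤ : Subgroup (Circle ≃ₜ Circle))) := {G | ∃ H : C(ℤ_[2], moebiusGroup),
      ∀ z, (G z : Circle ≃ₜ Circle) = (H (S z) : Circle ≃ₜ Circle)⁻¹ * H z}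
    obtain ⟨R, -, hR, hgood⟩ := exists_generic_minimal_collapsing hS le_top
      isPathConnected_moebiusGroup conditionA_moebiusGroup (A := A) fun G => Iff.rfl
    have hne : Nonempty (closure A) := by
      refine ⟨⟨ContinuousMap.const _ 1, subset_closure ⟨ContinuousMap.const _ 1, fun z => ?_⟩⟩⟩
      simp
    have hbaire : BaireSpace (closure A) := baireSpace_closure_of_isClosed (by simp) A
    obtain ⟨G, hG⟩ := (dense_of_mem_residual hR).nonempty
    obtain ⟨hmin, hc⟩ := hgood G hG
    have hT : ∀ x, (skewProduct S ⊤ (G : C(ℤ_[2], (⊤ : Subgroup (Circle ≃ₜ Circle)))) x).1 =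
      S x.1 := fun x => rfl
    have hZ : Infinite ℤ_[2] := inferInstance
    have hY : Nontrivial Circle := ⟨-1, 1, Circle.neg_ne_self 1⟩
    have heq := isEquicontinuousSystem_of_isometry hiso
    exact ⟨ℤ_[2] × Circle, ℤ_[2], inferInstance, inferInstance, inferInstance, inferInstance,
      inferInstance, inferInstance, inferInstance, inferInstance, inferInstance, hZ,
      skewProduct S ⊤ G, S, Prod.fst, hmin, hc.isWeylMeanEquicontinuous hiso hT,
      hc.isMaximalEquicontinuousFactor hT heq, hc.isIsomorphicExtensionVia hS.2 hT,
      hc.not_isAlmostOneToOneExtension hT heq⟩
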